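/- Let $\mathbb T=\mathbb R/2\pi\mathbb Z$, and for $f\in L_1(\mathbb T)$ (complex-valued) let $\widehat f_k=\frac1{2\pi}\int_{-\pi}^{\pi}f(t)e^{-ikt}\,dt$, $k\in\mathbb Z$. A point $x\in\mathbb R$ is called a $d$-point of $f$ if the function $F(y)=\int_0^y f(t)\,dt$ is differentiable at $x$, that is, if the finite limit $$d_f(x)=\lim_{h\to0}\frac1h\int_0^h f(x+t)\,dt$$ exists. Let $\alpha>0$ and $\beta>0$, and let $\varphi(x)=(1-|x|^\alpha)_+^\beta$ for $x\in\mathbb R$, where $u_+=\max(u,0)$. Then the following three conditions are equivalent: 1. $\beta>1$; 2. for every $f\in L_1(\mathbb T)$ and every $d$-point $x$ of $f$, $$\lim_{n\to\infty}\sum_{k=-\infty}^{\infty}\varphi\Big(\frac{k}{n+1}\Big)\widehat f_k e^{ikx}=d_f(x);$$ 3. for every $f\in L_1(\mathbb T)$ and every $d$-point $x$ of $f$, the Riesz means $\sum_{k=-\infty}^{\infty}\varphi\big(\frac{k}{n+1}\big)\widehat f_k e^{ikx}$ have some finite limit as $n\to\infty$. (Since $\varphi$ vanishes outside $(-1,1)$,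 the sums are over $|k|\le n$ only.) -/

import Mathlib

open Real Filter Topology MeasureTheory

noncomputable section

instance instFactTwoPiPos : Fact (0 < 2 * π) := ⟨Real.two_pi_pos⟩

/-- The point `x` is a `d`-point of the `2π`-periodic function `f` with value `d_f(x) = d`:
the primitive `F(y) = ∫_0^y f(t) dt` is differentiable at `x`, with derivative `d`. -/
def IsDPointWith (f : AddCircle (2 * π) → ℂ) (x : ℝ) (d : ℂ) : Prop :=
  HasDerivAt (fun y : ℝ => ∫ t in (0 : ℝ)..y, f (t : AddCircle (2 * π))) d x

/-- The linear means `∑_{k ∈ ℤ} φ(k / (n + 1)) f̂_k e^{ikx}` of the Fourier series of `f`. -/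
def multiplierMean (φ : ℝ → ℝ) (f : AddCircle (2 * π) → ℂ) (n : ℕ) (x : ℝ) : ℂ :=
  ∑' k : ℤ, (φ ((k : ℝ) / ((n : ℝ) + 1)) : ℂ) * fourierCoeff f k *
    Complex.exp (Complex.I * (k : ℂ) * (x : ℂ))

/-- The function `φ(x) = (1 - |x|^α)_+^β` that generates the Riesz means. -/
def rieszFun (α β : ℝ) (x : ℝ) : ℝ :=
  (max (1 - |x| ^ α) 0) ^ β

theorem rieszFun_eq_zero {α β : ℝ} (hα : 0 < α) (hβ : 0 < β) {x : ℝ} (hx : 1 ≤ |x|) :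
    rieszFun α β x = 0 := by
  have h : 1 ≤ |x| ^ α := Real.one_le_rpow hx hα.le
  rw [rieszFun, max_eq_right (by linarith), Real.zero_rpow hβ.ne']

/-- The series defining the Riesz means are finite sums over `|k| ≤ n`. -/
theorem multiplierMean_rieszFun {α β : ℝ} (hα : 0 < α) (hβ : 0 < β)
    (f : AddCircle (2 * π) → ℂ) (n : ℕ) (x : ℝ) :
    multiplierMean (rieszFun α β) f n x =
      ∑ k ∈ Finset.Icc (-(n : ℤ)) (n : ℤ),
        (rieszFun α β ((k : ℝ) / ((n : ℝ) + 1)) : ℂ) * fourierCoeff f k *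
          Complex.exp (Complex.I * (k : ℂ) * (x : ℂ)) := by
  refine tsum_eq_sum fun k hk => ?_
  have h1 : (n : ℤ) + 1 ≤ |k| := by
    rw [Finset.mem_Icc, ← abs_le] at hk
    omega
  have h2 : ((n : ℝ) + 1) ≤ |(k : ℝ)| := by exact_mod_cast h1
  have hn : (0 : ℝ) < (n : ℝ) + 1 := by positivity
  have h3 : 1 ≤ |(k : ℝ) / ((n : ℝ) + 1)| := by
    rw [abs_div, abs_of_pos hn, le_div_iff₀ hn]
    linarith
  rw [rieszFun_eq_zero hα hβ h3]
  simp

end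

noncomputable section

/-! ### Trigonometric polynomials -/

/-! Since condition 2 trivially gives condition 3, it suffices to prove convergence for `β > 1` and
to exhibit a divergent example for `β ≤ 1`.

Convergence. With `N = n + 1`, the mean is the integral of `f(x + t)` against `K_n(t) = ∑ φ(k/N)
e^{ikt}`, divided by `2π`. After subtracting `d`, integration by parts moves the derivative onto
`K_n`; the primitive `G` of `f(x + ·) - d` satisfies `G(t) = o(t)`. Hence it is enough that `∫_0^π t
|K_n'(t)| dt` is bounded and that its tails over `[a, π]` vanish (`tendsto_integral_mul_kernel`). On
the annulus `[π/(2m), π/m]` this moment is controlled by Cauchy–Schwarz and Parseval through the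
mixed difference, of steps `1` and `m`, of the coefficients `i k φ(k/N)` (`integral_annulus_sq_le`).
The step-`1` difference averages the derivative of `x φ(x)`, which for `β > 1` is Hölder continuous
and has a linear `L¹` modulus. Interpolating `ℓ²` between `ℓ^∞` and `ℓ¹` (`exists_tsum_stepDiff_le`)
bounds the annulus by a positive power of `m/N`, and the dyadic annuli sum to a geometric series.

Divergence. For `β ≤ 1`, `φ(1 - u) ≥ min(α, 1) u` (`mul_le_rieszFun_one_sub`), so the cut at
frequency `N` is too sharp. Take `q` with coefficients `k⁻²` on `L ≤ |k| ≤ K`, corrected by low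
nonnegative frequencies so that `q(0) = 0`. Its derivative is essentially a sine sum, hence
uniformly bounded, whereas one half of that sum taken at `0` is of size `log(K/L)`. The function
`(e^{iNt} q)'` has primitive `O(|t|)` and, for `N = 2M³`, `L = M²`, `K = M³`, bounded `L¹` norm. The
Riesz mean at `0` discards all frequencies `≥ N` and keeps a sum of size at least a multiple of `log
M` (`le_norm_sum_rieszFun_shiftedHump`). A lacunary superposition with weights `2^{-i}` keeps `0` a
`d`-point and makes the means unbounded there (`exists_divergent_rieszMean`). -/

theorem fourier_coe_two_pi (k : ℤ) (t : ℝ) :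
    fourier k (t : AddCircle (2 * π)) = Complex.exp (Complex.I * k * t) := by
  rw [fourier_coe_apply]
  congr 1
  have : (π : ℂ) ≠ 0 := by exact_mod_cast Real.pi_ne_zero
  push_cast
  field_simp

theorem norm_exp_I_mul_int_mul (k : ℤ) (t : ℝ) : ‖Complex.exp (Complex.I * k * t)‖ = 1 := by
  have : Complex.I * k * t = ((k * t : ℝ) : ℂ) * Complex.I := by push_cast; ring
  rw [this, Complex.norm_exp_ofReal_mul_I]

/-- The trigonometric polynomial with coefficients `b k`, `k ∈ s`. -/
def trigPoly (s : Finset ℤ) (b : ℤ → ℂ) (t : ℝ) : ℂ :=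
  ∑ k ∈ s, b k * Complex.exp (Complex.I * k * t)

/-- The trigonometric polynomial `trigPoly s b` as a function on the circle. -/
def circlePoly (s : Finset ℤ) (b : ℤ → ℂ) : C(AddCircle (2 * π), ℂ) :=
  ∑ k ∈ s, b k • fourier k

theorem circlePoly_coe (s : Finset ℤ) (b : ℤ → ℂ) (t : ℝ) :
    circlePoly s b (t : AddCircle (2 * π)) = trigPoly s b t := by
  simp only [circlePoly, trigPoly, ContinuousMap.coe_sum, Finset.sum_apply,
    ContinuousMap.coe_smul, Pi.smul_apply, smul_eq_mul, fourier_coe_two_pi]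

theorem continuous_trigPoly (s : Finset ℤ) (b : ℤ → ℂ) : Continuous (trigPoly s b) := by
  unfold trigPoly
  fun_prop

theorem hasDerivAt_trigPoly (s : Finset ℤ) (b : ℤ → ℂ) (t : ℝ) :
    HasDerivAt (trigPoly s b) (trigPoly s (fun k => Complex.I * k * b k) t) t := by
  unfold trigPoly
  refine HasDerivAt.fun_sum fun k _ => ?_
  have h1 : HasDerivAt (fun t : ℝ => Complex.I * k * (t : ℂ)) (Complex.I * k) t := by
    simpa using (Complex.ofRealCLM.hasDerivAt (x := t)).const_mul (Complex.I * (k : ℂ))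
  exact (h1.cexp.const_mul (b k)).congr_deriv (by ring)

theorem fourierCoeff_circlePoly (s : Finset ℤ) (b : ℤ → ℂ) (k : ℤ) :
    fourierCoeff (circlePoly s b) k = if k ∈ s then b k else 0 := by
  have h1 : ⇑(circlePoly s b) = ∑ j ∈ s, b j • ⇑(fourier j : C(AddCircle (2 * π), ℂ)) := by
    ext x
    simp [circlePoly]
  rw [h1, fourierCoeff.sum _ _ fun j _ => ?_, Finset.sum_apply]
  · simp only [fourierCoeff.const_smul, fourierCoeff_fourier, Pi.single_apply, smul_eq_mul,
      mul_ite, mul_one, mul_zero]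
    rw [Finset.sum_ite_eq]
  · exact ((map_continuous (fourier j)).integrable_of_hasCompactSupport
      (HasCompactSupport.of_compactSpace _)).smul (b j)

theorem integral_haarAddCircle_eq_intervalIntegral {E : Type*} [NormedAddCommGroup E]
    [NormedSpace ℝ E] (g : AddCircle (2 * π) → E) (a : ℝ) :
    ∫ y, g y ∂AddCircle.haarAddCircle =
      (2 * π)⁻¹ • ∫ t in a..a + 2 * π, g (t : AddCircle (2 * π)) := by
  rw [AddCircle.integral_haarAddCircle, AddCircle.intervalIntegral_preimage]

theorem integral_norm_sq_trigPoly (s : Finset ℤ) (b : ℤ → ℂ) :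
    ∫ t in (-π)..π, ‖trigPoly s b t‖ ^ 2 = 2 * π * ∑ k ∈ s, ‖b k‖ ^ 2 := by
  have h := tsum_sq_fourierCoeff
    (ContinuousMap.toLp (E := ℂ) 2 AddCircle.haarAddCircle ℂ (circlePoly s b))
  simp_rw [fourierCoeff_toLp, fourierCoeff_circlePoly] at h
  have h2 : ∫ y : AddCircle (2 * π), ‖(ContinuousMap.toLp (E := ℂ) 2
      AddCircle.haarAddCircle ℂ (circlePoly s b)) y‖ ^ 2 ∂AddCircle.haarAddCircle =
      ∫ y : AddCircle (2 * π), ‖circlePoly s b y‖ ^ 2 ∂AddCircle.haarAddCircle := by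
    refine integral_congr_ae ?_
    filter_upwards [ContinuousMap.coeFn_toLp (E := ℂ) (p := 2) (𝕜 := ℂ)
      AddCircle.haarAddCircle (circlePoly s b)] with y hy
    rw [hy]
  rw [h2, integral_haarAddCircle_eq_intervalIntegral _ (-π), tsum_eq_sum (s := s)] at h
  · simp_rw [circlePoly_coe] at h
    rw [show -π + 2 * π = π by ring] at h
    have h3 : ∑ k ∈ s, ‖if k ∈ s then b k else 0‖ ^ 2 = ∑ k ∈ s, ‖b k‖ ^ 2 :=
      Finset.sum_congr rfl fun k hk => by rw [if_pos hk]
    rw [← h3, h, smul_eq_mul]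
    field_simp
  · intro k hk
    simp [hk]

/-- The trigonometric series with coefficients `b`, used for finitely supported `b`. -/
def trigSeries (b : ℤ → ℂ) (t : ℝ) : ℂ :=
  ∑' k : ℤ, b k * Complex.exp (Complex.I * k * t)

theorem trigSeries_eq_trigPoly {s : Finset ℤ} {b : ℤ → ℂ} (hb : ∀ k ∉ s, b k = 0) :
    trigSeries b = trigPoly s b := by
  ext t
  exact tsum_eq_sum fun k hk => by rw [hb k hk, zero_mul]

theorem summable_of_support_finite {b : ℤ → ℂ} (hb : b.support.Finite) (e : ℤ → ℂ) :
    Summable fun k => b k * e k :=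
  summable_of_hasFiniteSupport (hb.subset fun _ hk => left_ne_zero_of_mul hk)

/-- The backward difference of step `m`. -/
def stepDiff (m : ℤ) (b : ℤ → ℂ) (k : ℤ) : ℂ :=
  b k - b (k - m)

theorem support_shift_finite {b : ℤ → ℂ} (hb : b.support.Finite) (m : ℤ) :
    (fun k => b (k - m)).support.Finite := by
  have := hb.preimage (f := fun k : ℤ => k - m) (fun x _ y _ h => by simpa using h)
  exact this

theorem support_stepDiff_finite {b : ℤ → ℂ} (hb : b.support.Finite) (m : ℤ) :
    (stepDiff m b).support.Finite :=
  (hb.union (support_shift_finite hb m)).subset (Function.support_sub _ _)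

/-- Where `1 - e^{imt}` is bounded below, the series is therefore controlled by its differenced
coefficients. -/
theorem trigSeries_stepDiff {b : ℤ → ℂ} (hb : b.support.Finite) (m : ℤ) (t : ℝ) :
    trigSeries (stepDiff m b) t =
      (1 - Complex.exp (Complex.I * m * t)) * trigSeries b t := by
  have h1 : trigSeries (fun k => b (k - m)) t =
      Complex.exp (Complex.I * m * t) * trigSeries b t := by
    unfold trigSeries
    rw [← tsum_mul_left, ← (Equiv.subRight m).tsum_eq
      (fun k => Complex.exp (Complex.I * m * t) * (b k * Complex.exp (Complex.I * k * t)))]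
    refine tsum_congr fun k => ?_
    simp only [Equiv.subRight_apply]
    rw [mul_left_comm, ← Complex.exp_add]
    congr 2
    push_cast
    ring
  rw [sub_mul, one_mul, ← h1]
  unfold trigSeries
  rw [← (summable_of_support_finite hb _).tsum_sub
    (summable_of_support_finite (support_shift_finite hb m) _)]
  exact tsum_congr fun k => by rw [stepDiff, sub_mul]

theorem continuous_trigSeries {b : ℤ → ℂ} (hb : b.support.Finite) :
    Continuous (trigSeries b) := by
  rw [trigSeries_eq_trigPoly (s := hb.toFinset) (by simp)]
  exact continuous_trigPoly _ _

theorem integral_norm_sq_trigSeries {b : ℤ → ℂ} (hb : b.support.Finite) :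
    ∫ t in (-π)..π, ‖trigSeries b t‖ ^ 2 = 2 * π * ∑' k, ‖b k‖ ^ 2 := by
  rw [trigSeries_eq_trigPoly (s := hb.toFinset) (by simp), integral_norm_sq_trigPoly,
    tsum_eq_sum (s := hb.toFinset)]
  intro k hk
  simpa using hk

/-- Cauchy–Schwarz against the constant `1`, from nonnegativity of the variance of `u`. -/
theorem sq_intervalIntegral_le {u : ℝ → ℝ} (hu : Continuous u) {a b : ℝ} (hab : a ≤ b) :
    (∫ t in a..b, u t) ^ 2 ≤ (b - a) * ∫ t in a..b, u t ^ 2 := by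
  rcases hab.eq_or_lt with rfl | hlt
  · simp
  set c := (∫ t in a..b, u t) with hc
  have h0 : 0 ≤ ∫ t in a..b, ((b - a) * u t - c) ^ 2 :=
    intervalIntegral.integral_nonneg hab fun _ _ => sq_nonneg _
  have h1 : ∫ t in a..b, ((b - a) * u t - c) ^ 2 =
      (b - a) ^ 2 * (∫ t in a..b, u t ^ 2) - 2 * (b - a) * c * c + (b - a) * c ^ 2 := by
    have : ∀ t, ((b - a) * u t - c) ^ 2 =
        ((b - a) ^ 2 * u t ^ 2 - 2 * (b - a) * c * u t) + c ^ 2 := fun t => by ring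
    simp_rw [this]
    rw [intervalIntegral.integral_add, intervalIntegral.integral_sub,
      intervalIntegral.integral_const_mul, intervalIntegral.integral_const_mul,
      intervalIntegral.integral_const, smul_eq_mul, ← hc]
    all_goals exact Continuous.intervalIntegrable (by fun_prop) _ _
  rw [h1] at h0
  have hpos : 0 < b - a := sub_pos.2 hlt
  have h2 : 0 ≤ (b - a) * ((b - a) * (∫ t in a..b, u t ^ 2) - c ^ 2) := by nlinarith
  nlinarith [nonneg_of_mul_nonneg_right h2 hpos]

theorem norm_one_sub_exp_sq (m : ℤ) (t : ℝ) :
    ‖1 - Complex.exp (Complex.I * m * t)‖ ^ 2 = 2 - 2 * Real.cos (m * t) := by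
  have h : Complex.I * m * t = ((m * t : ℝ) : ℂ) * Complex.I := by push_cast; ring
  have h2 := Real.sin_sq_add_cos_sq (m * t)
  rw [h, Complex.exp_mul_I, ← Complex.ofReal_cos, ← Complex.ofReal_sin, ← Complex.normSq_eq_norm_sq,
    Complex.normSq_apply]
  generalize Real.cos (m * t) = c at *
  generalize Real.sin (m * t) = s at *
  simp
  nlinarith

theorem sq_le_norm_one_sub_exp_sq {t : ℝ} (ht : |t| ≤ π) :
    t ^ 2 ≤ π ^ 2 / 4 * ‖1 - Complex.exp (Complex.I * (1 : ℤ) * t)‖ ^ 2 := by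
  rw [norm_one_sub_exp_sq]
  have h := Real.cos_le_one_sub_mul_cos_sq ht
  have h2 : 2 / π ^ 2 * t ^ 2 * (π ^ 2 / 2) = t ^ 2 := by
    field_simp
  have h3 : 0 < π ^ 2 / 2 := by positivity
  simp only [Int.cast_one, one_mul]
  nlinarith

/-- The step-`1` difference absorbs the weight `t`, and the step-`m` difference is harmless because
its factor is bounded below on this annulus. Cauchy–Schwarz over length `π/(2m)` and Parseval
finish. -/
theorem integral_annulus_sq_le {b : ℤ → ℂ} (hb : b.support.Finite) {m : ℕ} (hm : 1 ≤ m) :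
    (∫ t in (π / (2 * m))..(π / m), t * ‖trigSeries b t‖) ^ 2 ≤
      π ^ 4 / (8 * m) * ∑' k, ‖stepDiff m (stepDiff 1 b) k‖ ^ 2 := by
  have hm0 : (1 : ℝ) ≤ m := by exact_mod_cast hm
  have hpi := Real.pi_pos
  have hle : π / (2 * m) ≤ π / m := by
    gcongr
    linarith
  have hc := continuous_trigSeries hb
  have hb1 := support_stepDiff_finite hb 1
  have hb2 := support_stepDiff_finite hb1 m
  have hc2 := continuous_trigSeries hb2
  have hpim : π / m ≤ π := div_le_self hpi.le hm0
  refine (sq_intervalIntegral_le (by fun_prop) hle).trans ?_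
  have h1 : ∫ t in (π / (2 * m))..(π / m), (t * ‖trigSeries b t‖) ^ 2 ≤
      ∫ t in (π / (2 * m))..(π / m),
        π ^ 2 / 8 * ‖trigSeries (stepDiff m (stepDiff 1 b)) t‖ ^ 2 := by
    refine intervalIntegral.integral_mono_on hle
      (Continuous.intervalIntegrable (by fun_prop) _ _)
      (Continuous.intervalIntegrable (by fun_prop) _ _) fun t ht => ?_
    have ht0 : 0 < t := lt_of_lt_of_le (by positivity) ht.1
    have habs : |t| ≤ π := by rw [abs_of_pos ht0]; exact ht.2.trans hpim
    rw [trigSeries_stepDiff hb1, trigSeries_stepDiff hb, norm_mul, norm_mul, mul_pow, mul_pow,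
      mul_pow]
    have h2 := sq_le_norm_one_sub_exp_sq habs
    -- Here `mt` lies in `[π/2, π]`, so `cos(mt) ≤ 0`.
    have h3 : 2 ≤ ‖1 - Complex.exp (Complex.I * (m : ℤ) * t)‖ ^ 2 := by
      rw [norm_one_sub_exp_sq]
      have h4 : Real.cos ((m : ℤ) * t) ≤ 0 := by
        have e1 : π / (2 * m) * m = π / 2 := by field_simp
        have e2 : π / m * m = π := by field_simp
        refine Real.cos_nonpos_of_pi_div_two_le_of_le ?_ ?_
        · push_cast
          nlinarith [ht.1]
        · push_cast
          nlinarith [ht.2]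
      linarith
    calc t ^ 2 * ‖trigSeries b t‖ ^ 2
        ≤ (π ^ 2 / 4 * ‖1 - Complex.exp (Complex.I * (1 : ℤ) * t)‖ ^ 2) * ‖trigSeries b t‖ ^ 2 := by
          gcongr
      _ = π ^ 2 / 8 * (2 * (‖1 - Complex.exp (Complex.I * (1 : ℤ) * t)‖ ^ 2 *
          ‖trigSeries b t‖ ^ 2)) := by ring
      _ ≤ _ := by gcongr
  have h2 : ∫ t in (π / (2 * m))..(π / m), ‖trigSeries (stepDiff m (stepDiff 1 b)) t‖ ^ 2 ≤
      ∫ t in (-π)..π, ‖trigSeries (stepDiff m (stepDiff 1 b)) t‖ ^ 2 := by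
    refine intervalIntegral.integral_mono_interval ?_ hle hpim ?_
      (Continuous.intervalIntegrable (by fun_prop) _ _)
    · have : 0 ≤ π / (2 * m) := by positivity
      linarith
    · exact Eventually.of_forall fun t => by positivity
  rw [intervalIntegral.integral_const_mul] at h1
  rw [integral_norm_sq_trigSeries hb2] at h2
  have e : π / m - π / (2 * m) = π / (2 * m) := by field_simp; ring
  rw [e]
  calc π / (2 * m) * ∫ t in (π / (2 * m))..(π / m), (t * ‖trigSeries b t‖) ^ 2
      ≤ π / (2 * m) * (π ^ 2 / 8 *
        (2 * π * ∑' k, ‖stepDiff m (stepDiff 1 b) k‖ ^ 2)) := by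
        gcongr
        exact h1.trans (by gcongr)
    _ = _ := by
      field_simp

/-! ### Integration against kernels -/

/-- Integration by parts for a merely integrable `g`: Fubini applied to `g(t) K'(s)` on the triangle
`t < s`. -/
theorem intervalIntegral_mul_eq_sub_primitive {g K K' : ℝ → ℂ} {a b : ℝ} (hab : a ≤ b)
    (hg : IntervalIntegrable g volume a b) (hK : ∀ t, HasDerivAt K (K' t) t)
    (hK' : Continuous K') :
    ∫ t in a..b, g t * K t =
      K b * (∫ t in a..b, g t) - ∫ s in a..b, (∫ t in a..s, g t) * K' s := by
  set μ := volume.restrict (Set.Ioc a b) with hμ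
  have hgi : Integrable g μ := (intervalIntegrable_iff_integrableOn_Ioc_of_le hab).1 hg
  have hK'i : Integrable K' μ :=
    (intervalIntegrable_iff_integrableOn_Ioc_of_le hab).1 (hK'.intervalIntegrable _ _)
  have hKc : Continuous K := continuous_iff_continuousAt.2 fun t => (hK t).continuousAt
  let F : ℝ → ℝ → ℂ := fun t s => if t < s then g t * K' s else 0
  have hF : Integrable (Function.uncurry F) (μ.prod μ) := by
    have h1 := hgi.mul_prod hK'i
    have h2 : MeasurableSet {p : ℝ × ℝ | p.1 < p.2} := measurableSet_lt measurable_fst measurable_snd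
    refine (h1.indicator h2).congr (Eventually.of_forall fun p => ?_)
    simp [F, Function.uncurry, Set.indicator]
  have hswap := integral_integral_swap hF
  have e1 : ∀ t ∈ Set.Ioc a b, ∫ s, F t s ∂μ = g t * (K b - K t) := by
    intro t ht
    have : ∀ s, F t s = (Set.Ioi t).indicator (fun s => g t * K' s) s := by
      intro s
      simp [F, Set.indicator]
    simp_rw [this]
    rw [integral_indicator measurableSet_Ioi, hμ, Measure.restrict_restrict measurableSet_Ioi,
      Set.inter_comm, Set.Ioc_inter_Ioi, max_eq_right ht.1.le, integral_const_mul,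
      ← intervalIntegral.integral_of_le ht.2,
      intervalIntegral.integral_eq_sub_of_hasDerivAt (fun x _ => hK x)
        (hK'.intervalIntegrable _ _)]
  have e2 : ∀ s ∈ Set.Ioc a b, ∫ t, F t s ∂μ = (∫ t in a..s, g t) * K' s := by
    intro s hs
    have : ∀ t, F t s = (Set.Iio s).indicator (fun t => g t * K' s) t := by
      intro t
      simp [F, Set.indicator]
    simp_rw [this]
    have h3 : Set.Iio s ∩ Set.Ioc a b = Set.Ioo a s := by
      ext x
      simp only [Set.mem_inter_iff, Set.mem_Iio, Set.mem_Ioc, Set.mem_Ioo]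
      constructor
      · rintro ⟨h, h', _⟩
        exact ⟨h', h⟩
      · rintro ⟨h, h'⟩
        exact ⟨h', h, h'.le.trans hs.2⟩
    rw [integral_indicator measurableSet_Iio, hμ, Measure.restrict_restrict measurableSet_Iio,
      h3, integral_mul_const, ← integral_Ioc_eq_integral_Ioo,
      ← intervalIntegral.integral_of_le hs.1.le]
  rw [setIntegral_congr_fun measurableSet_Ioc e1, setIntegral_congr_fun measurableSet_Ioc e2,
    ← intervalIntegral.integral_of_le hab, ← intervalIntegral.integral_of_le hab] at hswap
  rw [← hswap, ← intervalIntegral.integral_const_mul, ← intervalIntegral.integral_sub]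
  · exact intervalIntegral.integral_congr fun t _ => by ring
  · exact hg.const_mul _
  · exact hg.mul_continuousOn (by fun_prop)

/-- Moving the base point of the primitive from `-π` to `0` costs a constant times `∫ K'`, which
vanishes because `K(-π) = K(π)`. -/
theorem intervalIntegral_mul_eq_sub_primitive_zero {g K K' : ℝ → ℂ}
    (hg : ∀ a b, IntervalIntegrable g volume a b) (hK : ∀ t, HasDerivAt K (K' t) t)
    (hK' : Continuous K') (hKpi : K (-π) = K π) :
    ∫ t in (-π)..π, g t * K t =
      K π * (∫ t in (-π)..π, g t) - ∫ s in (-π)..π, (∫ t in (0 : ℝ)..s, g t) * K' s := by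
  have hpi := Real.pi_pos
  rw [intervalIntegral_mul_eq_sub_primitive (by linarith) (hg _ _) hK hK']
  congr 1
  have h1 : ∀ s, (∫ t in (-π)..s, g t) * K' s =
      (∫ t in (-π)..0, g t) * K' s + (∫ t in (0 : ℝ)..s, g t) * K' s := fun s => by
    rw [← add_mul, intervalIntegral.integral_add_adjacent_intervals (hg _ _) (hg _ _)]
  have hc : Continuous fun s => ∫ t in (0 : ℝ)..s, g t :=
    intervalIntegral.continuous_primitive hg 0
  simp_rw [h1]
  rw [intervalIntegral.integral_add (Continuous.intervalIntegrable (by fun_prop) _ _)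
    (Continuous.intervalIntegrable (by fun_prop) _ _), intervalIntegral.integral_const_mul,
    intervalIntegral.integral_eq_sub_of_hasDerivAt (fun x _ => hK x)
        (hK'.intervalIntegrable _ _), hKpi, sub_self, mul_zero, zero_add]

/-- Kernels whose derivatives have bounded first absolute moments on `[0, π]`, concentrating
at the origin. -/
theorem tendsto_integral_mul_of_moment {D : ℕ → ℝ → ℂ} {A : ℝ} (hD : ∀ n, Continuous (D n))
    (hsymm : ∀ n t, ‖D n (-t)‖ = ‖D n t‖)
    (hA : ∀ n, ∫ t in (0 : ℝ)..π, t * ‖D n t‖ ≤ A)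
    (htail : ∀ a, 0 < a → a ≤ π →
      Tendsto (fun n => ∫ t in a..π, t * ‖D n t‖) atTop (𝓝 0))
    {G : ℝ → ℂ} (hG : Continuous G) (hG0 : G 0 = 0) (hG1 : HasDerivAt G 0 0) :
    Tendsto (fun n => ∫ t in (-π)..π, G t * D n t) atTop (𝓝 0) := by
  have hpi := Real.pi_pos
  set H : ℝ → ℝ := fun t => ‖G t‖ + ‖G (-t)‖ with hH
  have hHc : Continuous H := by fun_prop
  have hbound : ∀ n, ‖∫ t in (-π)..π, G t * D n t‖ ≤ ∫ t in (0 : ℝ)..π, H t * ‖D n t‖ := by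
    intro n
    have hDn := hD n
    have hi : ∀ a b, IntervalIntegrable (fun t => ‖G t‖ * ‖D n t‖) volume a b := fun a b =>
      Continuous.intervalIntegrable (by fun_prop) _ _
    refine (intervalIntegral.norm_integral_le_integral_norm (by linarith)).trans ?_
    simp_rw [norm_mul]
    rw [← intervalIntegral.integral_add_adjacent_intervals (hi (-π) 0) (hi 0 π)]
    have e : ∫ t in (-π)..0, ‖G t‖ * ‖D n t‖ = ∫ t in (0 : ℝ)..π, ‖G (-t)‖ * ‖D n t‖ := by
      have := intervalIntegral.integral_comp_neg (a := 0) (b := π) fun t => ‖G t‖ * ‖D n t‖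
      rw [neg_zero] at this
      rw [← this]
      simp_rw [hsymm]
    rw [e, ← intervalIntegral.integral_add (Continuous.intervalIntegrable (by fun_prop) _ _)
      (Continuous.intervalIntegrable (by fun_prop) _ _)]
    refine le_of_eq (intervalIntegral.integral_congr fun t _ => ?_)
    simp only [hH]
    ring
  have hA0 : 0 ≤ A := le_trans (intervalIntegral.integral_nonneg hpi.le fun t ht =>
    mul_nonneg ht.1 (norm_nonneg _)) (hA 0)
  rw [Metric.tendsto_atTop]
  intro ε hε
  -- Chosen so that `2ηA ≤ ε/2`; the `2` comes from folding `[-π, 0]` onto `[0, π]`, and `A + 1`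
  -- avoids division by zero.
  set η := ε / (4 * (A + 1)) with hη
  have hη0 : 0 < η := by positivity
  obtain ⟨δ, hδ0, hδpi, hδ⟩ : ∃ δ, 0 < δ ∧ δ ≤ π ∧ ∀ t ∈ Set.Icc 0 δ, H t ≤ 2 * η * t := by
    have h1 := (hasDerivAt_iff_isLittleO_nhds_zero.1 hG1).def hη0
    simp only [zero_add, hG0, sub_zero, smul_zero, Metric.eventually_nhds_iff,
      dist_zero_right] at h1
    obtain ⟨r, hr, h1⟩ := h1
    refine ⟨min (r / 2) π, by positivity, min_le_right _ _, fun t ht => ?_⟩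
    have h2 : ‖t‖ < r := by
      rw [Real.norm_of_nonneg ht.1]
      linarith [ht.2, min_le_left (r / 2) π]
    have h3 := h1 h2
    have h4 := h1 (y := -t) (by rwa [norm_neg])
    rw [norm_neg] at h4
    rw [Real.norm_of_nonneg ht.1] at h3 h4
    simp only [hH]
    linarith
  obtain ⟨B, hB⟩ := (isCompact_Icc (a := (0 : ℝ)) (b := π)).exists_bound_of_continuousOn
    hHc.continuousOn
  have hB0 : 0 ≤ B := (norm_nonneg _).trans (hB 0 ⟨le_rfl, hpi.le⟩)
  have h5 := (htail δ hδ0 hδpi).const_mul (B / δ)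
  rw [mul_zero, Metric.tendsto_atTop] at h5
  obtain ⟨n0, hn0⟩ := h5 (ε / 2) (by positivity)
  refine ⟨n0, fun n hn => ?_⟩
  rw [dist_zero_right]
  refine (hbound n).trans_lt ?_
  have hDn := hD n
  have hi : ∀ a b, IntervalIntegrable (fun t => H t * ‖D n t‖) volume a b := fun a b =>
    Continuous.intervalIntegrable (by fun_prop) _ _
  rw [← intervalIntegral.integral_add_adjacent_intervals (hi 0 δ) (hi δ π)]
  have p1 : ∫ t in (0 : ℝ)..δ, H t * ‖D n t‖ ≤ 2 * η * A := by
    calc ∫ t in (0 : ℝ)..δ, H t * ‖D n t‖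
        ≤ ∫ t in (0 : ℝ)..δ, 2 * η * (t * ‖D n t‖) := by
          refine intervalIntegral.integral_mono_on hδ0.le (hi _ _)
            (Continuous.intervalIntegrable (by fun_prop) _ _) fun t ht => ?_
          rw [← mul_assoc]
          exact mul_le_mul_of_nonneg_right (hδ t ht) (norm_nonneg _)
      _ = 2 * η * ∫ t in (0 : ℝ)..δ, t * ‖D n t‖ := intervalIntegral.integral_const_mul _ _
      _ ≤ 2 * η * A := by
          gcongr
          refine le_trans ?_ (hA n)
          refine intervalIntegral.integral_mono_interval le_rfl hδ0.le hδpi ?_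
            (Continuous.intervalIntegrable (by fun_prop) _ _)
          filter_upwards [ae_restrict_mem measurableSet_Ioc] with t ht
          exact mul_nonneg ht.1.le (norm_nonneg _)
  -- Away from `0`, boundedness of `H` is enough: `B ≤ (B/δ) t` for `t ≥ δ`.
  have p2 : ∫ t in δ..π, H t * ‖D n t‖ ≤ B / δ * ∫ t in δ..π, t * ‖D n t‖ := by
    rw [← intervalIntegral.integral_const_mul]
    refine intervalIntegral.integral_mono_on hδpi (hi _ _)
      (Continuous.intervalIntegrable (by fun_prop) _ _) fun t ht => ?_
    rw [← mul_assoc]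
    refine mul_le_mul_of_nonneg_right ?_ (norm_nonneg _)
    calc H t ≤ B := (le_abs_self _).trans (hB t ⟨hδ0.le.trans ht.1, ht.2⟩)
      _ = B / δ * δ := by field_simp
      _ ≤ B / δ * t := by
        gcongr
        exact ht.1
  have p3 := hn0 n hn
  rw [dist_zero_right] at p3
  have p4 := (le_abs_self _).trans_lt p3
  have p5 : 2 * η * A ≤ ε / 2 := by
    have : η * (A + 1) = ε / 4 := by rw [hη]; field_simp
    nlinarith
  linarith

/-- An approximate identity (in the sense of differentiating indefinite integrals) evaluated
against a locally integrable function at a point where its primitive has derivative zero. -/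
theorem tendsto_integral_mul_kernel {K D : ℕ → ℝ → ℂ} {A : ℝ}
    (hK : ∀ n t, HasDerivAt (K n) (D n t) t) (hD : ∀ n, Continuous (D n))
    (hKpi : ∀ n, K n (-π) = K n π) (hsymm : ∀ n t, ‖D n (-t)‖ = ‖D n t‖)
    (hA : ∀ n, ∫ t in (0 : ℝ)..π, t * ‖D n t‖ ≤ A)
    (htail : ∀ a, 0 < a → a ≤ π →
      Tendsto (fun n => ∫ t in a..π, t * ‖D n t‖) atTop (𝓝 0))
    (hcos : Tendsto (fun n => ∫ t in (-π)..π, (1 - Complex.cos t) * K n t) atTop (𝓝 0))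
    {g : ℝ → ℂ} (hg : ∀ a b, IntervalIntegrable g volume a b)
    (hg0 : HasDerivAt (fun y => ∫ t in (0 : ℝ)..y, g t) 0 0) :
    Tendsto (fun n => ∫ t in (-π)..π, g t * K n t) atTop (𝓝 0) := by
  have key : ∀ {g : ℝ → ℂ} (hg : ∀ a b, IntervalIntegrable g volume a b)
      (hg0 : HasDerivAt (fun y => ∫ t in (0 : ℝ)..y, g t) 0 0),
      Tendsto (fun n => K n π * (∫ t in (-π)..π, g t) - ∫ t in (-π)..π, g t * K n t)
        atTop (𝓝 0) := by
    intro g hg hg0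
    refine (tendsto_integral_mul_of_moment hD hsymm hA htail
      (intervalIntegral.continuous_primitive hg 0) (by simp) hg0).congr fun n => ?_
    rw [intervalIntegral_mul_eq_sub_primitive_zero hg (hK n) (hD n) (hKpi n)]
    ring
  have hc : Continuous fun t : ℝ => 1 - Complex.cos t := by fun_prop
  have hint : ∫ t in (-π)..π, (1 - Complex.cos (t : ℂ)) = 2 * π := by
    have h1 : ∀ t : ℝ, HasDerivAt (fun t : ℝ => (t : ℂ) - Complex.sin t) (1 - Complex.cos t) t := by
      intro t
      have h2 : HasDerivAt (fun t : ℝ => (t : ℂ)) 1 t := Complex.ofRealCLM.hasDerivAt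
      exact h2.sub ((Complex.hasDerivAt_sin t).comp_ofReal)
    rw [intervalIntegral.integral_eq_sub_of_hasDerivAt (fun t _ => h1 t)
      (hc.intervalIntegrable _ _)]
    simp
    ring
  -- The boundary term is isolated by testing with `1 - cos t`: its primitive has derivative zero at
  -- `0`, its integral is `2π ≠ 0`, and `hcos` handles its pairing with `K n`.
  have hKlim : Tendsto (fun n => K n π) atTop (𝓝 0) := by
    have h1 := key (g := fun t => 1 - Complex.cos t) (fun a b => hc.intervalIntegrable _ _) (by
      simpa using hc.integral_hasStrictDerivAt 0 0 |>.hasDerivAt)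
    have h2 := (h1.add hcos).mul_const (2 * π : ℂ)⁻¹
    rw [add_zero, zero_mul] at h2
    refine h2.congr fun n => ?_
    rw [hint, sub_add_cancel]
    have : (π : ℂ) ≠ 0 := by exact_mod_cast Real.pi_ne_zero
    field_simp
  have h1 := (hKlim.mul_const (∫ t in (-π)..π, g t)).sub (key hg hg0)
  rw [zero_mul, sub_zero] at h1
  exact h1.congr fun n => by ring

/-! ### Regularity of the functions `(1 - |x|^α)_+^γ` -/

theorem rieszFun_nonneg (α γ x : ℝ) : 0 ≤ rieszFun α γ x :=
  Real.rpow_nonneg (le_max_right _ _) _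

theorem max_one_sub_rpow_le_one (α x : ℝ) : max (1 - |x| ^ α) 0 ≤ 1 :=
  max_le (by linarith [Real.rpow_nonneg (abs_nonneg x) α]) zero_le_one

theorem rieszFun_le_one {α γ : ℝ} (hγ : 0 ≤ γ) (x : ℝ) : rieszFun α γ x ≤ 1 :=
  Real.rpow_le_one (le_max_right _ _) (max_one_sub_rpow_le_one α x) hγ

theorem rieszFun_neg (α γ x : ℝ) : rieszFun α γ (-x) = rieszFun α γ x := by
  simp [rieszFun]

theorem rieszFun_le_of_abs_le {α γ : ℝ} (hα : 0 ≤ α) (hγ : 0 ≤ γ) {x y : ℝ} (h : |x| ≤ |y|) :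
    rieszFun α γ y ≤ rieszFun α γ x := by
  refine Real.rpow_le_rpow (le_max_right _ _) (max_le_max ?_ le_rfl) hγ
  linarith [Real.rpow_le_rpow (abs_nonneg x) h hα]

theorem continuous_rieszFun {α γ : ℝ} (hα : 0 ≤ α) (hγ : 0 ≤ γ) : Continuous (rieszFun α γ) := by
  have h1 : Continuous fun x : ℝ => |x| ^ α := continuous_abs.rpow_const fun _ => Or.inr hα
  exact ((continuous_const.sub h1).max continuous_const).rpow_const fun _ => Or.inr hγ

/-- For `p ≤ 1` this is subadditivity of `x ↦ x^p`; for `p ≥ 1` Bernoulli's inequality at `d/c`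
gives the Lipschitz constant `p`. On `[0, 1]` lowering the exponent to `e` only enlarges the bound.
-/
theorem abs_rpow_sub_rpow_le {p e : ℝ} (hp : 0 < p) (he : 0 < e) (hep : e ≤ p) (he1 : e ≤ 1)
    {c d : ℝ} (hc : c ∈ Set.Icc (0 : ℝ) 1) (hd : d ∈ Set.Icc (0 : ℝ) 1) :
    |c ^ p - d ^ p| ≤ max p 1 * |c - d| ^ e := by
  wlog hcd : d ≤ c generalizing c d
  · rw [abs_sub_comm, abs_sub_comm c d]
    exact this hd hc (le_of_not_ge hcd)
  have hmono : d ^ p ≤ c ^ p := Real.rpow_le_rpow hd.1 hcd hp.le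
  have h0 : 0 ≤ c - d := sub_nonneg.2 hcd
  rw [abs_of_nonneg (sub_nonneg.2 hmono), abs_of_nonneg h0]
  have h1 : c - d ≤ 1 := by linarith [hc.2, hd.1]
  rcases h0.eq_or_lt with h | hpos
  · have : c = d := by linarith
    subst this
    simp [Real.zero_rpow he.ne']
  rcases le_total p 1 with hp1 | hp1
  · have h2 : c ^ p ≤ d ^ p + (c - d) ^ p := by
      have := Real.rpow_add_le_add_rpow hd.1 h0 hp.le hp1
      rwa [add_sub_cancel] at this
    have h3 : (c - d) ^ p ≤ (c - d) ^ e := Real.rpow_le_rpow_of_exponent_ge hpos h1 hep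
    rw [max_eq_right hp1]
    linarith
  · have hc0 : 0 < c := lt_of_lt_of_le hpos (by linarith [hd.1])
    have h2 := one_add_mul_self_le_rpow_one_add (s := d / c - 1)
      (by have := div_nonneg hd.1 hc0.le; linarith) hp1
    rw [add_sub_cancel, Real.div_rpow hd.1 hc0.le, le_div_iff₀ (by positivity)] at h2
    have h3 : c ^ p ≤ c := by
      simpa using Real.rpow_le_rpow_of_exponent_ge hc0 hc.2 hp1
    have h4 : c - d ≤ (c - d) ^ e := by
      simpa using Real.rpow_le_rpow_of_exponent_ge hpos h1 he1
    have h5 : c ^ p * (1 - d / c) ≤ c * (1 - d / c) := by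
      refine mul_le_mul_of_nonneg_right h3 ?_
      rw [sub_nonneg, div_le_one hc0]
      exact hcd
    have h6 : c * (1 - d / c) = c - d := by field_simp
    rw [max_eq_left hp1]
    have h7 : p * (c ^ p * (1 - d / c)) ≤ p * (c - d) ^ e := by
      gcongr
      linarith
    nlinarith

/-- Truncating the argument instead of the value keeps every base in `[0, 1]`, where
`abs_rpow_sub_rpow_le` applies. -/
theorem max_one_sub_rpow_eq {α : ℝ} (hα : 0 < α) (x : ℝ) :
    max (1 - |x| ^ α) 0 = 1 - (min |x| 1) ^ α := by
  rcases le_total |x| 1 with h | h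
  · rw [min_eq_left h, max_eq_left]
    linarith [Real.rpow_le_one (abs_nonneg x) h hα.le]
  · rw [min_eq_right h, Real.one_rpow, sub_self, max_eq_right]
    linarith [Real.one_le_rpow h hα.le]

/-- Hölder continuity of `(1 - |x|^α)_+^γ`. -/
theorem exists_holder_rieszFun {α γ a c : ℝ} (hα : 0 < α) (hγ : 0 < γ) (ha : 0 < a) (haα : a ≤ α)
    (ha1 : a ≤ 1) (hc : 0 < c) (hcγ : c ≤ γ) (hc1 : c ≤ 1) :
    ∃ C, 0 ≤ C ∧ ∀ x y, |rieszFun α γ x - rieszFun α γ y| ≤ C * |x - y| ^ (a * c) := by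
  refine ⟨max γ 1 * (max α 1) ^ c, by positivity, fun x y => ?_⟩
  have hmem : ∀ x : ℝ, max (1 - |x| ^ α) 0 ∈ Set.Icc (0 : ℝ) 1 := fun x =>
    ⟨le_max_right _ _, max_one_sub_rpow_le_one α x⟩
  have hmin : ∀ x : ℝ, min |x| 1 ∈ Set.Icc (0 : ℝ) 1 := fun x =>
    ⟨le_min (abs_nonneg _) zero_le_one, min_le_right _ _⟩
  refine (abs_rpow_sub_rpow_le hγ hc hcγ hc1 (hmem x) (hmem y)).trans ?_
  rw [mul_assoc]
  refine mul_le_mul_of_nonneg_left ?_ (by positivity)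
  rw [Real.rpow_mul (abs_nonneg _), ← Real.mul_rpow (by positivity) (by positivity)]
  refine Real.rpow_le_rpow (abs_nonneg _) ?_ hc.le
  rw [max_one_sub_rpow_eq hα, max_one_sub_rpow_eq hα, sub_sub_sub_cancel_left, abs_sub_comm]
  refine (abs_rpow_sub_rpow_le hα ha haα ha1 (hmin x) (hmin y)).trans ?_
  refine mul_le_mul_of_nonneg_left ?_ (by positivity)
  refine Real.rpow_le_rpow (abs_nonneg _) ?_ ha.le
  refine (abs_min_sub_min_le_max _ _ _ _).trans (max_le (abs_abs_sub_abs_le_abs_sub _ _) ?_)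
  simp

/-- The derivative of `x (1 - |x|^α)_+^β`. -/
def rieszDeriv (α β x : ℝ) : ℝ :=
  (1 + α * β) * rieszFun α β x - α * β * rieszFun α (β - 1) x

/-- With `u = 1 - |x|^α`, the product rule gives `u^β - αβ |x|^α u^(β-1)`. Writing `|x|^α = 1 - u`
leaves only powers of `u`, with no singular factor `|x|^(α-1)`. -/
theorem hasDerivAt_mul_rieszFun {α β : ℝ} (hα : 0 < α) (hβ : 1 < β) {x : ℝ} (hx0 : x ≠ 0)
    (hx1 : |x| ≠ 1) :
    HasDerivAt (fun x => x * rieszFun α β x) (rieszDeriv α β x) x := by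
  have hβ0 : 0 < β := by linarith
  rcases lt_or_gt_of_ne hx1 with h | h
  · have hu : 0 < 1 - |x| ^ α := by linarith [Real.rpow_lt_one (abs_nonneg x) h hα]
    have hax : 0 < |x| := abs_pos.2 hx0
    have h1 : HasDerivAt (fun y : ℝ => |y|) (SignType.sign x : ℝ) x := hasDerivAt_abs hx0
    have h2 := h1.rpow_const (p := α) (Or.inl hax.ne')
    have h3 := (h2.const_sub 1).rpow_const (p := β) (Or.inl hu.ne')
    have h4 := (hasDerivAt_id x).mul h3
    have hev : (fun y => y * rieszFun α β y) =ᶠ[𝓝 x]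
        (id * fun y => (1 - |y| ^ α) ^ β) := by
      filter_upwards [continuous_abs.continuousAt.eventually (gt_mem_nhds h)] with y hy
      have : 0 < 1 - |y| ^ α := by linarith [Real.rpow_lt_one (abs_nonneg y) hy hα]
      simp [rieszFun, max_eq_left this.le]
    refine (h4.congr_of_eventuallyEq hev).congr_deriv ?_
    have e1 : |x| ^ α = |x| ^ (α - 1) * |x| := by
      rw [Real.rpow_sub_one hax.ne']; field_simp
    have e2 : (1 - |x| ^ α) ^ β = (1 - |x| ^ α) ^ (β - 1) * (1 - |x| ^ α) := by
      rw [Real.rpow_sub_one hu.ne']; field_simp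
    have e3 : x * (SignType.sign x : ℝ) = |x| := by
      exact self_mul_sign x
    rw [rieszDeriv, rieszFun, rieszFun, max_eq_left hu.le, e2]
    simp only [id, one_mul]
    generalize (1 - |x| ^ α) ^ (β - 1) = w at *
    have e4 : x * (-((SignType.sign x : ℝ) * α * |x| ^ (α - 1)) * β * w) =
        -(α * β * w * |x| ^ α) := by
      rw [e1, ← e3]; ring
    rw [e4]
    ring
  · have hev : (fun y => y * rieszFun α β y) =ᶠ[𝓝 x] fun _ => 0 := by
      filter_upwards [continuous_abs.continuousAt.eventually (lt_mem_nhds h)] with y hy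
      rw [rieszFun_eq_zero hα hβ0 hy.le, mul_zero]
    refine ((hasDerivAt_const x (0 : ℝ)).congr_of_eventuallyEq hev).congr_deriv ?_
    rw [rieszDeriv, rieszFun_eq_zero hα hβ0 h.le, rieszFun_eq_zero hα (by linarith) h.le]
    ring

theorem continuous_rieszDeriv {α β : ℝ} (hα : 0 < α) (hβ : 1 < β) :
    Continuous (rieszDeriv α β) := by
  have h1 := continuous_rieszFun hα.le (γ := β) (by linarith)
  have h2 := continuous_rieszFun hα.le (γ := β - 1) (by linarith)
  unfold rieszDeriv
  fun_prop

/-- Differentiability may fail only at `0, ±1`, and the candidate derivative is continuous because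
`β - 1 > 0`. -/
theorem mul_rieszFun_sub_eq_integral {α β : ℝ} (hα : 0 < α) (hβ : 1 < β) (a b : ℝ) :
    b * rieszFun α β b - a * rieszFun α β a = ∫ x in a..b, rieszDeriv α β x := by
  have h1 := continuous_rieszFun hα.le (γ := β) (by linarith)
  refine (MeasureTheory.integral_eq_of_hasDerivAt_off_countable
    (fun x => x * rieszFun α β x) _ (s := {0, 1, -1}) (by simp) (by fun_prop) ?_
    ((continuous_rieszDeriv hα hβ).intervalIntegrable _ _)).symm
  rintro x ⟨_, hx⟩
  simp only [Set.mem_insert_iff, Set.mem_singleton_iff, not_or] at hx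
  refine hasDerivAt_mul_rieszFun hα hβ hx.1 fun h => ?_
  rcases (abs_eq zero_le_one).1 h with h | h
  · exact hx.2.1 h
  · exact hx.2.2 h

/-- The `L¹` modulus of continuity of a bump function is at most linear. -/
theorem integral_abs_sub_shift_le {v : ℝ → ℝ} (hv : Continuous v) (h0 : ∀ x, 0 ≤ v x)
    (h1 : ∀ x, v x ≤ 1) (hmono : ∀ x y, |x| ≤ |y| → v y ≤ v x) {R : ℝ} (hR : 0 ≤ R)
    (hsupp : ∀ x, R ≤ |x| → v x = 0) {s : ℝ} (hs : 0 ≤ s) :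
    ∫ y, |v y - v (y - s)| ≤ 2 * s := by
  set Q := R + s with hQ
  have hc : Continuous fun y => |v y - v (y - s)| := by fun_prop
  have hsup : Function.support (fun y => |v y - v (y - s)|) ⊆ Set.Ioc (s / 2 - Q) (s / 2 + Q) := by
    intro y hy
    by_contra hcon
    apply hy
    have hout : R ≤ |y| ∧ R ≤ |y - s| := by
      rw [Set.mem_Ioc, not_and_or, not_lt, not_le] at hcon
      rcases hcon with h | h
      · constructor
        · exact le_trans (by linarith) (neg_le_abs y)
        · exact le_trans (by linarith) (neg_le_abs (y - s))
      · constructor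
        · exact le_trans (by linarith) (le_abs_self y)
        · exact le_trans (by linarith) (le_abs_self (y - s))
    simp [hsupp _ hout.1, hsupp _ hout.2]
  rw [← intervalIntegral.integral_eq_integral_of_support_subset hsup,
    ← intervalIntegral.integral_add_adjacent_intervals (b := s / 2)
      (hc.intervalIntegrable _ _) (hc.intervalIntegrable _ _)]
  -- The reflection `y ↦ s - y` preserves the integrand because `v` is even.
  have e1 : ∫ y in (s / 2 - Q)..(s / 2), |v y - v (y - s)| =
      ∫ y in (s / 2)..(s / 2 + Q), |v y - v (y - s)| := by
    have := intervalIntegral.integral_comp_sub_left (a := s / 2) (b := s / 2 + Q)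
      (fun y => |v y - v (y - s)|) s
    rw [show s - (s / 2 + Q) = s / 2 - Q by ring, show s - s / 2 = s / 2 by ring] at this
    rw [← this]
    refine intervalIntegral.integral_congr fun y _ => ?_
    have hev : ∀ x, v (-x) = v x := fun x =>
      le_antisymm (hmono _ _ (by simp)) (hmono _ _ (by simp))
    rw [show s - y - s = -y by ring, hev, show s - y = -(y - s) by ring, hev, abs_sub_comm]
  -- To the right of `s/2`, `|y - s| ≤ |y|` fixes the sign of the difference, so the integral
  -- telescopes to end intervals of length `s`, where `0 ≤ v ≤ 1`.
  have e2 : ∫ y in (s / 2)..(s / 2 + Q), |v y - v (y - s)| ≤ s := by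
    have h3 : ∫ y in (s / 2)..(s / 2 + Q), |v y - v (y - s)| =
        (∫ y in (s / 2)..(s / 2 + Q), v (y - s)) - ∫ y in (s / 2)..(s / 2 + Q), v y := by
      rw [← intervalIntegral.integral_sub (Continuous.intervalIntegrable (by fun_prop) _ _)
        (hv.intervalIntegrable _ _)]
      refine intervalIntegral.integral_congr fun y hy => ?_
      rw [Set.uIcc_of_le (by linarith)] at hy
      have : |y - s| ≤ |y| := by
        rw [abs_of_nonneg (a := y) (by linarith [hy.1]), abs_le]
        constructor <;> linarith [hy.1]
      rw [abs_of_nonpos (by linarith [hmono _ _ this])]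
      ring
    rw [h3, intervalIntegral.integral_comp_sub_right,
      intervalIntegral.integral_interval_sub_interval_comm (hv.intervalIntegrable _ _)
        (hv.intervalIntegrable _ _) (hv.intervalIntegrable _ _)]
    have h4 : 0 ≤ ∫ y in (s / 2 + Q - s)..(s / 2 + Q), v y :=
      intervalIntegral.integral_nonneg (by linarith) fun y _ => h0 y
    have h5 : ∫ y in (s / 2 - s)..(s / 2), v y ≤ ∫ y in (s / 2 - s)..(s / 2), (1 : ℝ) :=
      intervalIntegral.integral_mono_on (by linarith) (hv.intervalIntegrable _ _)
        (continuous_const.intervalIntegrable _ _) fun y _ => h1 y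
    simp at h5
    linarith
  rw [e1]
  linarith

/-! ### The derivative of the Riesz kernel -/

theorem integrable_of_eq_zero_of_le_abs {v : ℝ → ℝ} (hv : Continuous v) {R : ℝ}
    (h : ∀ x, R ≤ |x| → v x = 0) : Integrable v := by
  refine hv.integrable_of_hasCompactSupport
    (HasCompactSupport.of_support_subset_isCompact (isCompact_Icc (a := -R) (b := R)) ?_)
  intro x hx
  rw [Set.mem_Icc, ← abs_le]
  by_contra hcon
  exact hx (h x (not_le.1 hcon).le)

/-- `rieszDeriv` is a combination of two bumps `rieszFun α γ` with `γ > 0`, each Hölder and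
unimodal. The `L¹` bound is uniform in the dilation `N` because dilates are still bumps of height at
most `1`. -/
theorem exists_shift_bounds_rieszDeriv {α β : ℝ} (hα : 0 < α) (hβ : 1 < β) :
    ∃ C E : ℝ, 0 ≤ C ∧ 0 < E ∧ (∀ x y, |rieszDeriv α β x - rieszDeriv α β y| ≤ C * |x - y| ^ E) ∧
      ∀ N s : ℝ, 0 < N → 0 ≤ s →
        Integrable (fun y => |rieszDeriv α β (y / N) - rieszDeriv α β ((y - s) / N)|) ∧
        ∫ y, |rieszDeriv α β (y / N) - rieszDeriv α β ((y - s) / N)| ≤ C * s := by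
  have ha : 0 < min α 1 := lt_min hα one_pos
  have hc : 0 < min (β - 1) 1 := lt_min (by linarith) one_pos
  obtain ⟨C1, hC1, h1⟩ := exists_holder_rieszFun (γ := β) hα (by linarith) ha (min_le_left _ _)
    (min_le_right _ _) hc ((min_le_left _ _).trans (by linarith)) (min_le_right _ _)
  obtain ⟨C2, hC2, h2⟩ := exists_holder_rieszFun (γ := β - 1) hα (by linarith) ha (min_le_left _ _)
    (min_le_right _ _) hc (min_le_left _ _) (min_le_right _ _)
  set E := min α 1 * min (β - 1) 1 with hE
  have hp : 0 ≤ α * β := by nlinarith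
  have hsplit : ∀ x y, |rieszDeriv α β x - rieszDeriv α β y| ≤
      (1 + α * β) * |rieszFun α β x - rieszFun α β y| +
        α * β * |rieszFun α (β - 1) x - rieszFun α (β - 1) y| := by
    intro x y
    have : rieszDeriv α β x - rieszDeriv α β y =
      (1 + α * β) * (rieszFun α β x - rieszFun α β y) -
        α * β * (rieszFun α (β - 1) x - rieszFun α (β - 1) y) := by
      unfold rieszDeriv; ring
    rw [this]
    refine (abs_sub _ _).trans ?_
    rw [abs_mul, abs_mul, abs_of_nonneg hp, abs_of_nonneg (by linarith : 0 ≤ 1 + α * β)]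
  have hshift : ∀ γ, 0 < γ → ∀ N s : ℝ, 0 < N → 0 ≤ s →
      Integrable (fun y => |rieszFun α γ (y / N) - rieszFun α γ ((y - s) / N)|) ∧
      ∫ y, |rieszFun α γ (y / N) - rieszFun α γ ((y - s) / N)| ≤ 2 * s := by
    intro γ hγ N s hN hs
    have hcont : Continuous fun y => rieszFun α γ (y / N) :=
      (continuous_rieszFun hα.le hγ.le).comp (continuous_id.div_const N)
    have hsupp : ∀ x, N ≤ |x| → rieszFun α γ (x / N) = 0 := fun x hx => by
      refine rieszFun_eq_zero hα hγ ?_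
      rwa [abs_div, abs_of_pos hN, one_le_div hN]
    have hi := integrable_of_eq_zero_of_le_abs hcont hsupp
    exact ⟨(hi.sub (hi.comp_sub_right s)).abs, integral_abs_sub_shift_le hcont
      (fun x => rieszFun_nonneg _ _ _) (fun x => rieszFun_le_one hγ.le _)
      (fun x y hxy => rieszFun_le_of_abs_le hα.le hγ.le (by
        rw [abs_div, abs_div]; gcongr)) hN.le hsupp hs⟩
  refine ⟨(1 + α * β) * (C1 + 2) + α * β * (C2 + 2), E, by positivity, by positivity,
    fun x y => ?_, fun N s hN hs => ?_⟩
  · have hr : 0 ≤ |x - y| ^ E := Real.rpow_nonneg (abs_nonneg _) _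
    calc |rieszDeriv α β x - rieszDeriv α β y|
        ≤ (1 + α * β) * (C1 * |x - y| ^ E) + α * β * (C2 * |x - y| ^ E) :=
          (hsplit x y).trans (by gcongr; exacts [h1 x y, h2 x y])
      _ ≤ _ := by nlinarith [mul_nonneg hp hr]
  · obtain ⟨i1, j1⟩ := hshift β (by linarith) N s hN hs
    obtain ⟨i2, j2⟩ := hshift (β - 1) (by linarith) N s hN hs
    have i3 := (i1.const_mul (1 + α * β)).add (i2.const_mul (α * β))
    have hcd := continuous_rieszDeriv hα hβ
    have i4 : Integrable fun y => |rieszDeriv α β (y / N) - rieszDeriv α β ((y - s) / N)| := by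
      refine i3.mono' (Continuous.aestronglyMeasurable (by fun_prop))
        (Eventually.of_forall fun y => ?_)
      rw [Real.norm_eq_abs, abs_abs]
      exact hsplit _ _
    refine ⟨i4, ?_⟩
    calc ∫ y, |rieszDeriv α β (y / N) - rieszDeriv α β ((y - s) / N)|
        ≤ ∫ y, ((1 + α * β) * |rieszFun α β (y / N) - rieszFun α β ((y - s) / N)| +
          α * β * |rieszFun α (β - 1) (y / N) - rieszFun α (β - 1) ((y - s) / N)|) :=
          integral_mono i4 i3 fun y => hsplit _ _
      _ ≤ (1 + α * β) * (2 * s) + α * β * (2 * s) := by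
          rw [integral_add (i1.const_mul _) (i2.const_mul _), integral_const_mul,
            integral_const_mul]
          gcongr
      _ ≤ _ := by nlinarith [mul_nonneg hp hs, mul_nonneg hC1 hs, mul_nonneg hC2 hs,
          mul_nonneg (mul_nonneg hp hC1) hs, mul_nonneg (mul_nonneg hp hC2) hs]

/-- The Fourier coefficients of the derivative of the Riesz kernel. -/
def rieszDerivCoeff (α β : ℝ) (n : ℕ) (k : ℤ) : ℂ :=
  Complex.I * k * rieszFun α β ((k : ℝ) / ((n : ℝ) + 1))

theorem rieszFun_div_eq_zero {α β : ℝ} (hα : 0 < α) (hβ : 0 < β) {n : ℕ} {k : ℤ}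
    (hk : k ∉ Finset.Icc (-(n : ℤ)) n) : rieszFun α β ((k : ℝ) / ((n : ℝ) + 1)) = 0 := by
  have h1 : (n : ℤ) + 1 ≤ |k| := by
    rw [Finset.mem_Icc, ← abs_le] at hk
    omega
  have h2 : ((n : ℝ) + 1) ≤ |(k : ℝ)| := by exact_mod_cast h1
  have hn : (0 : ℝ) < (n : ℝ) + 1 := by positivity
  refine rieszFun_eq_zero hα hβ ?_
  rwa [abs_div, abs_of_pos hn, one_le_div hn]

theorem rieszDerivCoeff_eq_zero {α β : ℝ} (hα : 0 < α) (hβ : 0 < β) {n : ℕ} {k : ℤ}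
    (hk : k ∉ Finset.Icc (-(n : ℤ)) n) : rieszDerivCoeff α β n k = 0 := by
  rw [rieszDerivCoeff, rieszFun_div_eq_zero hα hβ hk]
  simp

theorem support_rieszDerivCoeff_finite {α β : ℝ} (hα : 0 < α) (hβ : 0 < β) (n : ℕ) :
    (rieszDerivCoeff α β n).support.Finite := by
  refine (Finset.Icc (-(n : ℤ)) n).finite_toSet.subset fun k hk => ?_
  by_contra hcon
  exact hk (rieszDerivCoeff_eq_zero hα hβ hcon)

/-- The unit increment of `y φ(y/N)` is the integral of `rieszDeriv α β (y/N)`; the second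
difference translates that integrand by `m`. -/
theorem norm_stepDiff_rieszDerivCoeff {α β : ℝ} (hα : 0 < α) (hβ : 1 < β) (n m : ℕ) (k : ℤ) :
    ‖stepDiff m (stepDiff 1 (rieszDerivCoeff α β n)) k‖ =
      |∫ y in ((k : ℝ) - 1)..k, (rieszDeriv α β (y / ((n : ℝ) + 1)) -
        rieszDeriv α β ((y - m) / ((n : ℝ) + 1)))| := by
  have hN : (0 : ℝ) < (n : ℝ) + 1 := by positivity
  have hc := continuous_rieszDeriv hα hβ
  have h1 : ∀ a b : ℝ, b * rieszFun α β (b / ((n : ℝ) + 1)) - a * rieszFun α β (a / ((n : ℝ) + 1)) =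
      ∫ y in a..b, rieszDeriv α β (y / ((n : ℝ) + 1)) := by
    intro a b
    rw [intervalIntegral.integral_comp_div _ hN.ne', ← mul_rieszFun_sub_eq_integral hα hβ,
      smul_eq_mul]
    field_simp
  have h2 : ∫ y in ((k : ℝ) - 1)..k, (rieszDeriv α β (y / ((n : ℝ) + 1)) -
        rieszDeriv α β ((y - m) / ((n : ℝ) + 1))) =
      (k * rieszFun α β (k / ((n : ℝ) + 1)) -
        (k - 1) * rieszFun α β ((k - 1) / ((n : ℝ) + 1))) -
      ((k - m) * rieszFun α β ((k - m) / ((n : ℝ) + 1)) -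
        (k - 1 - m) * rieszFun α β ((k - 1 - m) / ((n : ℝ) + 1))) := by
    rw [intervalIntegral.integral_sub (Continuous.intervalIntegrable (by fun_prop) _ _)
      (Continuous.intervalIntegrable (by fun_prop) _ _), h1, h1,
      intervalIntegral.integral_comp_sub_right
        (fun y => rieszDeriv α β (y / ((n : ℝ) + 1)))]
  rw [h2]
  have h3 : stepDiff m (stepDiff 1 (rieszDerivCoeff α β n)) k = Complex.I *
      (((k * rieszFun α β (k / ((n : ℝ) + 1)) -
        (k - 1) * rieszFun α β ((k - 1) / ((n : ℝ) + 1))) -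
      ((k - m) * rieszFun α β ((k - m) / ((n : ℝ) + 1)) -
        (k - 1 - m) * rieszFun α β ((k - 1 - m) / ((n : ℝ) + 1))) : ℝ) : ℂ) := by
    simp only [stepDiff, rieszDerivCoeff]
    rw [show k - (m : ℤ) - 1 = k - 1 - m by ring]
    push_cast
    ring
  rw [h3, norm_mul, Complex.norm_I, one_mul, Complex.norm_real, Real.norm_eq_abs]

/-- `∑ d² ≤ sup d · ∑ d`: the Hölder modulus bounds the supremum by `C (m/N)^E` and the `L¹` modulus
bounds the sum by `C m`. -/
theorem exists_tsum_stepDiff_le {α β : ℝ} (hα : 0 < α) (hβ : 1 < β) :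
    ∃ C E : ℝ, 0 ≤ C ∧ 0 < E ∧ ∀ n m : ℕ,
      ∑' k, ‖stepDiff m (stepDiff 1 (rieszDerivCoeff α β n)) k‖ ^ 2 ≤
        C * m * ((m : ℝ) / ((n : ℝ) + 1)) ^ E := by
  obtain ⟨C, E, hC, hE, hhol, hL1⟩ := exists_shift_bounds_rieszDeriv hα hβ
  refine ⟨C * C, E, by positivity, hE, fun n m => ?_⟩
  have hN : (0 : ℝ) < (n : ℝ) + 1 := by positivity
  obtain ⟨hi, hint⟩ := hL1 ((n : ℝ) + 1) m hN (by positivity)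
  set W : ℝ → ℝ := fun y => |rieszDeriv α β (y / ((n : ℝ) + 1)) -
    rieszDeriv α β ((y - m) / ((n : ℝ) + 1))| with hW
  set d : ℤ → ℝ := fun k => ‖stepDiff m (stepDiff 1 (rieszDerivCoeff α β n)) k‖ with hd
  have hcd := continuous_rieszDeriv hα hβ
  have hWc : Continuous W := by fun_prop
  -- The intervals `[k - 1, k]` are written with offset `-1` to match the tiling of the line in
  -- `hsum`.
  have hdW : ∀ k : ℤ, d k ≤ ∫ y in ((-1 : ℝ) + k)..((-1 : ℝ) + k + 1), W y := by
    intro k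
    simp only [hd]
    rw [norm_stepDiff_rieszDerivCoeff hα hβ, show (-1 : ℝ) + k + 1 = k by ring,
      show (-1 : ℝ) + k = k - 1 by ring]
    exact intervalIntegral.abs_integral_le_integral_abs (μ := volume) (by linarith)
  have hWb : ∀ y, W y ≤ C * ((m : ℝ) / ((n : ℝ) + 1)) ^ E := by
    intro y
    refine (hhol _ _).trans_eq ?_
    rw [← sub_div, sub_sub_cancel, abs_of_nonneg (by positivity)]
  have hdb : ∀ k, d k ≤ C * ((m : ℝ) / ((n : ℝ) + 1)) ^ E := by
    intro k
    refine (hdW k).trans ?_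
    have := intervalIntegral.integral_mono_on (μ := volume) (a := (-1 : ℝ) + k) (b := (-1 : ℝ) + k + 1)
      (by linarith) (hWc.intervalIntegrable _ _) (continuous_const.intervalIntegrable _ _)
      fun y _ => hWb y
    simpa using this
  have hfin := support_stepDiff_finite (support_stepDiff_finite
    (support_rieszDerivCoeff_finite hα (by linarith : 0 < β) n) 1) m
  have hsum : HasSum (fun k : ℤ => ∫ y in ((-1 : ℝ) + k)..((-1 : ℝ) + k + 1), W y) (∫ y, W y) :=
    hi.hasSum_intervalIntegral (-1)
  have hd0 : ∀ k, 0 ≤ d k := fun k => norm_nonneg _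
  have hs1 : Summable d := .of_nonneg_of_le hd0 hdW hsum.summable
  have hs2 : Summable fun k => d k ^ 2 :=
    .of_nonneg_of_le (fun k => sq_nonneg _) (fun k => by
      rw [sq]; exact mul_le_mul_of_nonneg_right (hdb k) (hd0 k)) (hs1.mul_left _)
  calc ∑' k, d k ^ 2 ≤ ∑' k, C * ((m : ℝ) / ((n : ℝ) + 1)) ^ E * d k := by
        refine hs2.tsum_le_tsum (fun k => ?_) (hs1.mul_left _)
        rw [sq]; exact mul_le_mul_of_nonneg_right (hdb k) (hd0 k)
    _ = C * ((m : ℝ) / ((n : ℝ) + 1)) ^ E * ∑' k, d k := tsum_mul_left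
    _ ≤ C * ((m : ℝ) / ((n : ℝ) + 1)) ^ E * (C * m) := by
        have : ∑' k, d k ≤ C * m :=
          (hs1.tsum_le_tsum hdW hsum.summable).trans (hsum.tsum_eq.trans_le hint)
        gcongr
    _ = _ := by ring

/-- The first moment of the derivative of the Riesz kernel over a dyadic annulus. -/
theorem exists_integral_annulus_le {α β : ℝ} (hα : 0 < α) (hβ : 1 < β) :
    ∃ C E : ℝ, 0 ≤ C ∧ 0 < E ∧ ∀ n m : ℕ, 1 ≤ m →
      ∫ t in (π / (2 * m))..(π / m), t * ‖trigSeries (rieszDerivCoeff α β n) t‖ ≤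
        C * ((m : ℝ) / ((n : ℝ) + 1)) ^ E := by
  obtain ⟨C, E, hC, hE, h⟩ := exists_tsum_stepDiff_le hα hβ
  refine ⟨Real.sqrt (π ^ 4 / 8 * C), E / 2, by positivity, by positivity, fun n m hm => ?_⟩
  have hm0 : (0 : ℝ) < m := by exact_mod_cast hm
  have h1 := integral_annulus_sq_le
    (support_rieszDerivCoeff_finite hα (by linarith : 0 < β) n) hm
  refine abs_le_of_sq_le_sq' ?_ (by positivity) |>.2
  refine h1.trans ?_
  have hr : (((m : ℝ) / ((n : ℝ) + 1)) ^ (E / 2)) ^ 2 = ((m : ℝ) / ((n : ℝ) + 1)) ^ E := by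
    rw [← Real.rpow_natCast, ← Real.rpow_mul (by positivity)]
    norm_num
  rw [mul_pow, Real.sq_sqrt (by positivity), hr]
  calc π ^ 4 / (8 * m) * ∑' k, ‖stepDiff m (stepDiff 1 (rieszDerivCoeff α β n)) k‖ ^ 2
      ≤ π ^ 4 / (8 * m) * (C * m * ((m : ℝ) / ((n : ℝ) + 1)) ^ E) := by
        gcongr
        exact h n m
    _ = _ := by field_simp

/-! ### Convergence of the Riesz means for `β > 1` -/

theorem trigSeries_neg (b : ℤ → ℂ) (t : ℝ) :
    trigSeries b (-t) = trigSeries (fun k => b (-k)) t := by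
  unfold trigSeries
  rw [← (Equiv.neg ℤ).tsum_eq]
  refine tsum_congr fun k => ?_
  simp

/-- The kernel of the Riesz means. -/
def rieszKernel (α β : ℝ) (n : ℕ) : ℝ → ℂ :=
  trigSeries fun k => (rieszFun α β ((k : ℝ) / ((n : ℝ) + 1)) : ℂ)

theorem rieszKernel_eq_trigPoly {α β : ℝ} (hα : 0 < α) (hβ : 0 < β) (n : ℕ) :
    rieszKernel α β n = trigPoly (Finset.Icc (-(n : ℤ)) n)
      fun k => (rieszFun α β ((k : ℝ) / ((n : ℝ) + 1)) : ℂ) :=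
  trigSeries_eq_trigPoly fun k hk => by rw [rieszFun_div_eq_zero hα hβ hk, Complex.ofReal_zero]

theorem rieszKernel_neg (α β : ℝ) (n : ℕ) (t : ℝ) :
    rieszKernel α β n (-t) = rieszKernel α β n t := by
  rw [rieszKernel, trigSeries_neg]
  congr 1
  ext k
  push_cast
  rw [neg_div, rieszFun_neg]

theorem hasDerivAt_rieszKernel {α β : ℝ} (hα : 0 < α) (hβ : 0 < β) (n : ℕ) (t : ℝ) :
    HasDerivAt (rieszKernel α β n) (trigSeries (rieszDerivCoeff α β n) t) t := by
  rw [rieszKernel_eq_trigPoly hα hβ, trigSeries_eq_trigPoly fun k hk =>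
    rieszDerivCoeff_eq_zero hα hβ hk]
  exact hasDerivAt_trigPoly _ _ t

theorem norm_trigSeries_rieszDerivCoeff_neg (α β : ℝ) (n : ℕ) (t : ℝ) :
    ‖trigSeries (rieszDerivCoeff α β n) (-t)‖ = ‖trigSeries (rieszDerivCoeff α β n) t‖ := by
  have h : (fun k => rieszDerivCoeff α β n (-k)) = fun k => -rieszDerivCoeff α β n k := by
    ext k
    simp only [rieszDerivCoeff]
    push_cast
    rw [neg_div, rieszFun_neg]
    ring
  rw [trigSeries_neg, h]
  have h2 : trigSeries (fun k => -rieszDerivCoeff α β n k) t =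
      -trigSeries (rieszDerivCoeff α β n) t := by
    simp only [trigSeries, neg_mul, tsum_neg]
  rw [h2, norm_neg]

theorem norm_trigSeries_rieszDerivCoeff_le {α β : ℝ} (hα : 0 < α) (hβ : 0 < β) (n : ℕ) (t : ℝ) :
    ‖trigSeries (rieszDerivCoeff α β n) t‖ ≤ 2 * ((n : ℝ) + 1) ^ 2 := by
  rw [trigSeries_eq_trigPoly fun k hk => rieszDerivCoeff_eq_zero hα hβ hk]
  refine (norm_sum_le _ _).trans ?_
  have h1 : ∀ k ∈ Finset.Icc (-(n : ℤ)) n,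
      ‖rieszDerivCoeff α β n k * Complex.exp (Complex.I * k * t)‖ ≤ n := by
    intro k hk
    rw [norm_mul, norm_exp_I_mul_int_mul, mul_one, rieszDerivCoeff, norm_mul, norm_mul,
      Complex.norm_I, one_mul, Complex.norm_intCast, Complex.norm_real, Real.norm_eq_abs,
      abs_of_nonneg (rieszFun_nonneg _ _ _)]
    rw [Finset.mem_Icc, ← abs_le] at hk
    have h2 : |(k : ℝ)| ≤ n := by exact_mod_cast hk
    calc |(k : ℝ)| * rieszFun α β (k / ((n : ℝ) + 1)) ≤ n * 1 :=
          mul_le_mul h2 (rieszFun_le_one hβ.le _) (rieszFun_nonneg _ _ _) (by positivity)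
      _ = n := mul_one _
  refine (Finset.sum_le_card_nsmul _ _ _ h1).trans ?_
  have h3 : (Finset.Icc (-(n : ℤ)) n).card = 2 * n + 1 := by
    rw [Int.card_Icc]
    omega
  rw [h3, nsmul_eq_mul]
  push_cast
  nlinarith [(Nat.cast_nonneg n : (0 : ℝ) ≤ n)]

theorem integral_dyadic_eq_sum {u : ℝ → ℝ} (hu : Continuous u) (J : ℕ) :
    ∫ t in (π / 2 ^ J)..π, u t =
      ∑ j ∈ Finset.range J, ∫ t in (π / (2 * ((2 ^ j : ℕ) : ℝ)))..(π / ((2 ^ j : ℕ) : ℝ)), u t := by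
  induction J with
  | zero => simp
  | succ J ih =>
    rw [Finset.sum_range_succ, ← ih, pow_succ', add_comm]
    push_cast
    exact (intervalIntegral.integral_add_adjacent_intervals (hu.intervalIntegrable _ _)
      (hu.intervalIntegrable _ _)).symm

/-- The annuli with `m = 2^i ≤ N` contribute a geometric series dominated by its last term; on the
remaining core, of length at most `π/N`, the trivial bound `|K_n'| ≤ 2N²` suffices. -/
theorem exists_integral_moment_le {α β : ℝ} (hα : 0 < α) (hβ : 1 < β) :
    ∃ A, ∀ n : ℕ, ∫ t in (0 : ℝ)..π, t * ‖trigSeries (rieszDerivCoeff α β n) t‖ ≤ A := by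
  have hβ0 : 0 < β := by linarith
  have hpi := Real.pi_pos
  obtain ⟨C, E, hC, hE, h⟩ := exists_integral_annulus_le hα hβ
  set r : ℝ := 2 ^ E with hr
  have hr1 : 1 < r := Real.one_lt_rpow one_lt_two hE
  refine ⟨2 * π ^ 2 + C * (r / (r - 1)), fun n => ?_⟩
  set N : ℝ := (n : ℝ) + 1 with hN
  have hN1 : 1 ≤ N := by rw [hN]; linarith [(Nat.cast_nonneg n : (0 : ℝ) ≤ n)]
  have hN0 : 0 < N := by linarith
  -- `2^j ≤ N < 2^(j+1)`: the upper bound makes the core short, the lower one keeps the geometric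
  -- sum at most a multiple of `N^E`.
  obtain ⟨j, hj1, hj2⟩ := exists_nat_pow_near hN1 one_lt_two
  have hc : Continuous fun t => t * ‖trigSeries (rieszDerivCoeff α β n) t‖ :=
    continuous_id.mul (continuous_trigSeries (support_rieszDerivCoeff_finite hα hβ0 n)).norm
  rw [← intervalIntegral.integral_add_adjacent_intervals (b := π / 2 ^ (j + 1))
    (hc.intervalIntegrable _ _) (hc.intervalIntegrable _ _)]
  refine add_le_add ?_ ?_
  · have hle : π / 2 ^ (j + 1) ≤ π / N := by gcongr
    calc ∫ t in (0 : ℝ)..(π / 2 ^ (j + 1)), t * ‖trigSeries (rieszDerivCoeff α β n) t‖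
        ≤ ∫ t in (0 : ℝ)..(π / 2 ^ (j + 1)), π / N * (2 * N ^ 2) := by
          refine intervalIntegral.integral_mono_on (by positivity) (hc.intervalIntegrable _ _)
            (continuous_const.intervalIntegrable _ _) fun t ht => ?_
          exact mul_le_mul (ht.2.trans hle) (norm_trigSeries_rieszDerivCoeff_le hα hβ0 n t)
            (norm_nonneg _) (by positivity)
      _ = π / 2 ^ (j + 1) * (π / N * (2 * N ^ 2)) := by simp; ring
      _ ≤ π / N * (π / N * (2 * N ^ 2)) := by gcongr
      _ = 2 * π ^ 2 := by field_simp
  · rw [integral_dyadic_eq_sum hc]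
    calc _ ≤ ∑ i ∈ Finset.range (j + 1), C * (r ^ i / N ^ E) := by
          refine Finset.sum_le_sum fun i _ => ?_
          refine (h n (2 ^ i) Nat.one_le_two_pow).trans_eq ?_
          rw [Real.div_rpow (by positivity) hN0.le, hr, ← Real.rpow_natCast ((2 : ℝ) ^ E),
            ← Real.rpow_mul (by norm_num), mul_comm E, Real.rpow_mul (by norm_num)]
          push_cast
          rw [Real.rpow_natCast]
      _ = C * ((∑ i ∈ Finset.range (j + 1), r ^ i) / N ^ E) := by
          rw [← Finset.mul_sum, Finset.sum_div]
      _ ≤ C * (r / (r - 1)) := by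
          refine mul_le_mul_of_nonneg_left ?_ hC
          have hNE : 0 < N ^ E := by positivity
          rw [geom_sum_eq hr1.ne', div_div, div_le_div_iff₀ (by nlinarith) (by linarith)]
          have h2 : r ^ j ≤ N ^ E := by
            rw [hr, ← Real.rpow_natCast, ← Real.rpow_mul (by norm_num), mul_comm,
              Real.rpow_mul (by norm_num), Real.rpow_natCast]
            exact Real.rpow_le_rpow (by positivity) hj1 hE.le
          have h3 : r ^ (j + 1) - 1 ≤ r * N ^ E := by
            rw [pow_succ']
            nlinarith
          have h4 : 0 ≤ r - 1 := by linarith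
          nlinarith

/-- Finitely many dyadic annuli, independent of `n`, cover `[a, π]`, and each contribution is
`O((m/N)^E)` with `m` fixed. -/
theorem tendsto_integral_moment_tail {α β : ℝ} (hα : 0 < α) (hβ : 1 < β) {a : ℝ} (ha : 0 < a)
    (hapi : a ≤ π) :
    Tendsto (fun n : ℕ => ∫ t in a..π, t * ‖trigSeries (rieszDerivCoeff α β n) t‖)
      atTop (𝓝 0) := by
  have hβ0 : 0 < β := by linarith
  have hpi := Real.pi_pos
  obtain ⟨C, E, hC, hE, h⟩ := exists_integral_annulus_le hα hβ
  obtain ⟨J, hJ⟩ := pow_unbounded_of_one_lt (π / a) (one_lt_two : (1 : ℝ) < 2)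
  have hJa : π / 2 ^ J ≤ a := by
    rw [div_lt_iff₀ ha] at hJ
    rw [div_le_iff₀ (by positivity)]
    linarith
  have hlim : Tendsto (fun n : ℕ => ∑ j ∈ Finset.range J,
      C * (((2 ^ j : ℕ) : ℝ) / ((n : ℝ) + 1)) ^ E) atTop (𝓝 0) := by
    have h0 : (0 : ℝ) = ∑ j ∈ Finset.range J, C * 0 ^ E := by
      simp [Real.zero_rpow hE.ne']
    rw [h0]
    refine tendsto_finsetSum _ fun j _ => Tendsto.const_mul _ ?_
    refine Tendsto.rpow_const ?_ (Or.inr hE.le)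
    exact (tendsto_const_nhds).div_atTop
      (tendsto_atTop_add_const_right _ _ tendsto_natCast_atTop_atTop)
  refine squeeze_zero (fun n => intervalIntegral.integral_nonneg hapi fun t ht =>
    mul_nonneg (ha.le.trans ht.1) (norm_nonneg _)) (fun n => ?_) hlim
  have hc : Continuous fun t => t * ‖trigSeries (rieszDerivCoeff α β n) t‖ :=
    continuous_id.mul (continuous_trigSeries (support_rieszDerivCoeff_finite hα hβ0 n)).norm
  have h1 : ∫ t in a..π, t * ‖trigSeries (rieszDerivCoeff α β n) t‖ ≤
      ∫ t in (π / 2 ^ J)..π, t * ‖trigSeries (rieszDerivCoeff α β n) t‖ := by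
    refine intervalIntegral.integral_mono_interval hJa hapi le_rfl ?_
      (hc.intervalIntegrable _ _)
    filter_upwards [ae_restrict_mem measurableSet_Ioc] with t ht
    have : 0 < π / 2 ^ J := by positivity
    exact mul_nonneg (this.trans ht.1).le (norm_nonneg _)
  refine h1.trans ?_
  rw [integral_dyadic_eq_sum hc]
  exact Finset.sum_le_sum fun j _ => h n (2 ^ j) Nat.one_le_two_pow

theorem intervalIntegrable_of_integrable_haarAddCircle {f : AddCircle (2 * π) → ℂ}
    (hf : Integrable f AddCircle.haarAddCircle) (a b : ℝ) :
    IntervalIntegrable (fun t : ℝ => f (t : AddCircle (2 * π))) volume a b := by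
  have h1 : Integrable f volume := by
    rw [← memLp_one_iff_integrable] at hf ⊢
    exact memLp_haarAddCircle_iff.1 hf
  have h2 := (AddCircle.measurePreserving_mk (2 * π) 0).integrable_comp_of_integrable h1
  have hper : Function.Periodic (fun t : ℝ => f (t : AddCircle (2 * π))) (2 * π) := fun t => by
    simp
  refine hper.intervalIntegrable₀ Real.two_pi_pos.ne' ?_ a b
  rw [intervalIntegrable_iff_integrableOn_Ioc_of_le Real.two_pi_pos.le]
  rw [zero_add] at h2
  exact h2

theorem multiplierMean_eq_integral_rieszKernel {α β : ℝ} (hα : 0 < α) (hβ : 0 < β)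
    {f : AddCircle (2 * π) → ℂ} (hf : Integrable f AddCircle.haarAddCircle) (n : ℕ) (x : ℝ) :
    multiplierMean (rieszFun α β) f n x =
      (2 * π : ℂ)⁻¹ * ∫ t in (-π)..π, f ((x + t : ℝ) : AddCircle (2 * π)) * rieszKernel α β n t := by
  have hi : IntervalIntegrable (fun t : ℝ => f ((x + t : ℝ) : AddCircle (2 * π)))
      volume (-π) π := by
    have := (intervalIntegrable_of_integrable_haarAddCircle hf (x + -π) (x + π)).comp_add_left x
    simpa using this
  have hcoef : ∀ k : ℤ, fourierCoeff f k * Complex.exp (Complex.I * k * x) =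
      (2 * π : ℂ)⁻¹ * ∫ t in (-π)..π, f ((x + t : ℝ) : AddCircle (2 * π)) *
        Complex.exp (Complex.I * k * ((-t : ℝ) : ℂ)) := by
    intro k
    rw [fourierCoeff_eq_intervalIntegral f k (x - π), show x - π + 2 * π = x + π by ring,
      show x - π = x + -π by ring, ← intervalIntegral.integral_comp_add_left, Complex.real_smul,
      mul_assoc, ← intervalIntegral.integral_mul_const]
    push_cast
    rw [one_div]
    congr 1
    refine intervalIntegral.integral_congr fun t _ => ?_
    simp only [smul_eq_mul]
    rw [fourier_coe_two_pi, mul_right_comm, ← Complex.exp_add, mul_comm]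
    congr 2
    push_cast
    ring
  rw [multiplierMean_rieszFun hα hβ]
  have hterm : ∀ k : ℤ, (rieszFun α β ((k : ℝ) / ((n : ℝ) + 1)) : ℂ) * fourierCoeff f k *
      Complex.exp (Complex.I * k * x) = (2 * π : ℂ)⁻¹ * ∫ t in (-π)..π,
        (rieszFun α β ((k : ℝ) / ((n : ℝ) + 1)) : ℂ) *
          (f ((x + t : ℝ) : AddCircle (2 * π)) * Complex.exp (Complex.I * k * ((-t : ℝ) : ℂ))) := by
    intro k
    rw [mul_assoc, hcoef, mul_left_comm, intervalIntegral.integral_const_mul]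
  simp_rw [hterm]
  rw [← Finset.mul_sum, ← intervalIntegral.integral_finsetSum]
  · congr 1
    refine intervalIntegral.integral_congr fun t _ => ?_
    rw [← rieszKernel_neg, rieszKernel_eq_trigPoly hα hβ, trigPoly, Finset.mul_sum]
    exact Finset.sum_congr rfl fun k _ => by ring
  · intro k _
    exact (hi.mul_continuousOn (by fun_prop)).const_mul _

theorem multiplierMean_circlePoly (φ : ℝ → ℝ) (s : Finset ℤ) (b : ℤ → ℂ) (n : ℕ) (x : ℝ) :
    multiplierMean φ (circlePoly s b) n x =
      ∑ k ∈ s, (φ ((k : ℝ) / ((n : ℝ) + 1)) : ℂ) * b k * Complex.exp (Complex.I * k * x) := by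
  rw [multiplierMean, tsum_eq_sum (s := s)]
  · exact Finset.sum_congr rfl fun k hk => by rw [fourierCoeff_circlePoly, if_pos hk]
  · intro k hk
    rw [fourierCoeff_circlePoly, if_neg hk, mul_zero, zero_mul]

theorem integrable_circlePoly (s : Finset ℤ) (b : ℤ → ℂ) :
    Integrable (circlePoly s b) AddCircle.haarAddCircle :=
  (map_continuous (circlePoly s b)).integrable_of_hasCompactSupport
    (HasCompactSupport.of_compactSpace _)

theorem rieszFun_zero {α : ℝ} (hα : 0 < α) (β : ℝ) : rieszFun α β 0 = 1 := by
  simp [rieszFun, Real.zero_rpow hα.ne']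

/-- Read off by applying the mean to the constant `1`. -/
theorem integral_rieszKernel {α β : ℝ} (hα : 0 < α) (hβ : 0 < β) (n : ℕ) :
    ∫ t in (-π)..π, rieszKernel α β n t = 2 * π := by
  have h := multiplierMean_eq_integral_rieszKernel hα hβ (integrable_circlePoly {0} fun _ => 1) n 0
  have hpi : (π : ℂ) ≠ 0 := by exact_mod_cast Real.pi_ne_zero
  rw [multiplierMean_circlePoly] at h
  simp_rw [circlePoly_coe] at h
  simp [trigPoly, rieszFun_zero hα] at h
  field_simp at h
  rw [← h, mul_comm]

/-- The integral is `2π` times the mean of `1 - cos` at `0`, that is `2π (1 - φ(1/N))`, and `φ` is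
continuous with `φ(0) = 1`. -/
theorem tendsto_integral_one_sub_cos_mul_rieszKernel {α β : ℝ} (hα : 0 < α) (hβ : 0 < β) :
    Tendsto (fun n => ∫ t in (-π)..π, (1 - Complex.cos t) * rieszKernel α β n t) atTop (𝓝 0) := by
  have hpi : (π : ℂ) ≠ 0 := by exact_mod_cast Real.pi_ne_zero
  have hne : (2 * π : ℂ) ≠ 0 := mul_ne_zero two_ne_zero hpi
  have h1 : ∀ n, ∫ t in (-π)..π, (1 - Complex.cos t) * rieszKernel α β n t =
      2 * π * (1 - rieszFun α β (1 / ((n : ℝ) + 1)) : ℂ) := by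
    intro n
    have h := multiplierMean_eq_integral_rieszKernel hα hβ
      (integrable_circlePoly {0, 1, -1} fun k => if k = 0 then 1 else -1 / 2) n 0
    rw [multiplierMean_circlePoly] at h
    simp_rw [circlePoly_coe, zero_add] at h
    have h2 : ∀ t : ℝ, trigPoly {0, 1, -1} (fun k => if k = 0 then 1 else -1 / 2) t =
        1 - Complex.cos t := by
      intro t
      simp [trigPoly, Complex.cos]
      ring_nf
    simp_rw [h2] at h
    rw [eq_inv_mul_iff_mul_eq₀ hne] at h
    rw [← h]
    congr 1
    simp [rieszFun_zero hα, neg_div, rieszFun_neg]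
    ring
  simp_rw [h1]
  have h3 : Tendsto (fun n : ℕ => rieszFun α β (1 / ((n : ℝ) + 1))) atTop (𝓝 1) := by
    have h4 := ((continuous_rieszFun hα.le hβ.le).tendsto 0).comp
      tendsto_one_div_add_atTop_nhds_zero_nat
    rwa [rieszFun_zero hα] at h4
  have h4 := ((Complex.continuous_ofReal.tendsto 1).comp h3).const_sub 1 |>.const_mul (2 * π : ℂ)
  simpa using h4

theorem tendsto_multiplierMean_rieszFun {α β : ℝ} (hα : 0 < α) (hβ : 1 < β)
    {f : AddCircle (2 * π) → ℂ} (hf : Integrable f AddCircle.haarAddCircle) {x : ℝ} {d : ℂ}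
    (hd : IsDPointWith f x d) :
    Tendsto (fun n : ℕ => multiplierMean (rieszFun α β) f n x) atTop (𝓝 d) := by
  have hβ0 : 0 < β := by linarith
  have hpi : (π : ℂ) ≠ 0 := by exact_mod_cast Real.pi_ne_zero
  obtain ⟨A, hA⟩ := exists_integral_moment_le hα hβ
  have hfi := intervalIntegrable_of_integrable_haarAddCircle hf
  have hgi : ∀ a b, IntervalIntegrable (fun t : ℝ => f ((x + t : ℝ) : AddCircle (2 * π)))
      volume a b := fun a b => by
    simpa using (hfi (x + a) (x + b)).comp_add_left x
  have hcK : ∀ n, Continuous (rieszKernel α β n) := fun n =>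
    continuous_iff_continuousAt.2 fun t => (hasDerivAt_rieszKernel hα hβ0 n t).continuousAt
  have hderiv : HasDerivAt (fun y => ∫ t in (0 : ℝ)..y,
      (f ((x + t : ℝ) : AddCircle (2 * π)) - d)) 0 0 := by
    have h1 : (fun y => ∫ t in (0 : ℝ)..y, (f ((x + t : ℝ) : AddCircle (2 * π)) - d)) =
        fun y => ((∫ t in (0 : ℝ)..(x + y), f (t : AddCircle (2 * π))) -
          ∫ t in (0 : ℝ)..x, f (t : AddCircle (2 * π))) - y • d := by
      ext y
      rw [intervalIntegral.integral_sub (hgi _ _) (continuous_const.intervalIntegrable _ _),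
        intervalIntegral.integral_comp_add_left (fun t : ℝ => f (t : AddCircle (2 * π))),
        add_zero, intervalIntegral.integral_const, sub_zero,
        intervalIntegral.integral_interval_sub_left (hfi _ _) (hfi _ _)]
    rw [h1]
    have h2 : HasDerivAt (fun y : ℝ => ∫ t in (0 : ℝ)..(x + y), f (t : AddCircle (2 * π))) d 0 := by
      refine HasDerivAt.comp_const_add
        (f := fun y : ℝ => ∫ t in (0 : ℝ)..y, f (t : AddCircle (2 * π))) x 0 ?_
      rw [add_zero]
      exact hd
    have h3 : HasDerivAt (fun y : ℝ => y • d) ((1 : ℝ) • d) 0 :=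
      (hasDerivAt_id (0 : ℝ)).smul_const d
    exact ((h2.sub_const _).sub h3).congr_deriv (by simp)
  have key := tendsto_integral_mul_kernel (A := A) (K := fun n => rieszKernel α β n)
    (fun n t => hasDerivAt_rieszKernel hα hβ0 n t)
    (fun n => continuous_trigSeries (support_rieszDerivCoeff_finite hα hβ0 n))
    (fun n => rieszKernel_neg α β n π) (norm_trigSeries_rieszDerivCoeff_neg α β) hA
    (fun a ha hapi => tendsto_integral_moment_tail hα hβ ha hapi)
    (tendsto_integral_one_sub_cos_mul_rieszKernel hα hβ0)
    (fun a b => (hgi a b).sub (continuous_const.intervalIntegrable _ _)) hderiv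
  have h5 := (key.const_mul (2 * π : ℂ)⁻¹).add_const d
  rw [mul_zero, zero_add] at h5
  refine h5.congr fun n => ?_
  rw [multiplierMean_eq_integral_rieszKernel hα hβ0 hf]
  simp_rw [sub_mul]
  rw [intervalIntegral.integral_sub ((hgi _ _).mul_continuousOn (hcK n).continuousOn)
    (Continuous.intervalIntegrable (by have := hcK n; fun_prop) _ _),
    intervalIntegral.integral_const_mul, integral_rieszKernel hα hβ0]
  field_simp
  ring

/-! ### A uniform bound for sine sums -/

/-- Abel summation; the induction carries the sum with its boundary term removed. -/
theorem abs_sum_range_mul_le_of_antitone {c z : ℕ → ℝ} {B : ℝ} (hc : Antitone c)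
    (hc0 : ∀ i, 0 ≤ c i) (hB : ∀ m, |∑ i ∈ Finset.range m, z i| ≤ B) (m : ℕ) :
    |∑ i ∈ Finset.range m, c i * z i| ≤ c 0 * B := by
  have hstep : |(∑ i ∈ Finset.range m, c i * z i) - c m * ∑ i ∈ Finset.range m, z i| ≤
      B * (c 0 - c m) := by
    induction m with
    | zero => simp
    | succ m ih =>
      have h1 : (∑ i ∈ Finset.range (m + 1), c i * z i) -
          c (m + 1) * ∑ i ∈ Finset.range (m + 1), z i =
          ((∑ i ∈ Finset.range m, c i * z i) - c m * ∑ i ∈ Finset.range m, z i) +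
          (c m - c (m + 1)) * ∑ i ∈ Finset.range (m + 1), z i := by
        rw [Finset.sum_range_succ (fun i => c i * z i), Finset.sum_range_succ z]
        ring
      have h2 : 0 ≤ c m - c (m + 1) := sub_nonneg.2 (hc m.le_succ)
      rw [h1]
      refine (abs_add_le _ _).trans ?_
      rw [abs_mul, abs_of_nonneg h2]
      nlinarith [mul_le_mul_of_nonneg_left (hB (m + 1)) h2]
  have h3 : |c m * ∑ i ∈ Finset.range m, z i| ≤ c m * B := by
    rw [abs_mul, abs_of_nonneg (hc0 m)]
    exact mul_le_mul_of_nonneg_left (hB m) (hc0 m)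
  rw [abs_le] at *
  constructor <;> nlinarith

/-- Multiplying by `2 sin(t/2)` telescopes the sum, and Jordan's inequality gives `sin(t/2) ≥ t/π`.
-/
theorem abs_sum_sin_le {t : ℝ} (ht : 0 < t) (htpi : t ≤ π) (a m : ℕ) :
    |∑ i ∈ Finset.range m, Real.sin (((a + i : ℕ) : ℝ) * t)| ≤ π / t := by
  have hs : t / π ≤ Real.sin (t / 2) := by
    have := Real.mul_le_sin (x := t / 2) (by linarith) (by linarith)
    calc t / π = 2 / π * (t / 2) := by ring
      _ ≤ _ := this
  have hpi := Real.pi_pos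
  have hs0 : 0 < t / π := by positivity
  have htel : 2 * Real.sin (t / 2) * ∑ i ∈ Finset.range m, Real.sin (((a + i : ℕ) : ℝ) * t) =
      Real.cos ((a : ℝ) * t - t / 2) - Real.cos (((a + m : ℕ) : ℝ) * t - t / 2) := by
    induction m with
    | zero => simp
    | succ m ih =>
      rw [Finset.sum_range_succ, mul_add, ih]
      have h1 : (((a + (m + 1) : ℕ) : ℝ)) * t - t / 2 = ((a + m : ℕ) : ℝ) * t + t / 2 := by
        push_cast; ring
      rw [h1, Real.cos_add, Real.cos_sub (((a + m : ℕ) : ℝ) * t)]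
      ring
  have h2 : |2 * Real.sin (t / 2) * ∑ i ∈ Finset.range m, Real.sin (((a + i : ℕ) : ℝ) * t)| ≤ 2 := by
    rw [htel]
    refine (abs_sub _ _).trans ?_
    linarith [Real.abs_cos_le_one ((a : ℝ) * t - t / 2),
      Real.abs_cos_le_one (((a + m : ℕ) : ℝ) * t - t / 2)]
  rw [abs_mul, abs_mul, abs_of_pos (by linarith : 0 < Real.sin (t / 2)),
    abs_of_pos (two_pos : (0 : ℝ) < 2)] at h2
  rw [le_div_iff₀ ht]
  have h3 : |∑ i ∈ Finset.range m, Real.sin (((a + i : ℕ) : ℝ) * t)| * (t / π) ≤ 1 := by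
    nlinarith [abs_nonneg (∑ i ∈ Finset.range m, Real.sin (((a + i : ℕ) : ℝ) * t))]
  rw [← mul_div_assoc, div_le_one hpi] at h3
  exact h3

theorem abs_sum_Ico_sin_div_le {t : ℝ} (ht : |t| ≤ π) {L : ℕ} (hL : 1 ≤ L) (K : ℕ) :
    |∑ j ∈ Finset.Ico L K, Real.sin (j * t) / j| ≤ 1 + π := by
  have hpi := Real.pi_pos
  wlog htpos : 0 < t generalizing t
  · rcases (not_lt.1 htpos).eq_or_lt with rfl | hneg
    · simp; linarith
    · have := this (t := -t) (by rwa [abs_neg]) (by linarith)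
      simpa only [mul_neg, Real.sin_neg, neg_div, Finset.sum_neg_distrib, abs_neg] using this
  rw [abs_of_pos htpos] at ht
  rcases lt_or_ge K L with hKL | hKL
  · rw [Finset.Ico_eq_empty (by omega)]
    simp; linarith
  -- Below `p` each term is at most `t` in absolute value; from `p` on, Abel summation gains the
  -- factor `1/p ≤ t` against `π/t`.
  set p := ⌈1 / t⌉₊ with hp
  have hp1 : 1 / t ≤ p := Nat.le_ceil _
  have hp2 : (p : ℝ) < 1 / t + 1 := Nat.ceil_lt_add_one (by positivity)
  have hhead : ∀ c : ℕ, L ≤ c → (c = L ∨ c ≤ p) →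
      |∑ j ∈ Finset.Ico L c, Real.sin (j * t) / j| ≤ 1 := by
    rintro c hLc (rfl | hcp)
    · simp
    have h1 : ∀ j ∈ Finset.Ico L c, |Real.sin (j * t) / j| ≤ t := by
      intro j hj
      have hj0 : (0 : ℝ) < j := by
        have := (Finset.mem_Ico.1 hj).1
        exact_mod_cast (by omega : 0 < j)
      rw [abs_div, abs_of_pos hj0, div_le_iff₀ hj0]
      refine Real.abs_sin_le_abs.trans ?_
      rw [abs_of_pos (by positivity), mul_comm]
    refine (Finset.abs_sum_le_sum_abs _ _).trans ((Finset.sum_le_card_nsmul _ _ _ h1).trans ?_)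
    rw [Nat.card_Ico, nsmul_eq_mul]
    -- `L ≥ 1` leaves at most `p - 1` terms, and `p - 1 < 1/t`.
    have h2 : ((c - L : ℕ) : ℝ) ≤ 1 / t := by
      have h3 : c - L + 1 ≤ p := by omega
      have h4 : ((c - L : ℕ) : ℝ) + 1 ≤ p := by exact_mod_cast h3
      linarith
    calc ((c - L : ℕ) : ℝ) * t ≤ 1 / t * t := by gcongr
      _ = 1 := by field_simp
  have htail : ∀ a : ℕ, p ≤ a → |∑ j ∈ Finset.Ico a K, Real.sin (j * t) / j| ≤ π := by
    intro a hpa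
    have ha : 1 / t ≤ a := hp1.trans (by exact_mod_cast hpa)
    have ha0 : (0 : ℝ) < a := lt_of_lt_of_le (by positivity) ha
    rw [Finset.sum_Ico_eq_sum_range]
    have hc : Antitone fun i : ℕ => (((a + i : ℕ) : ℝ))⁻¹ := by
      intro i j hij
      have : (0 : ℝ) < ((a + i : ℕ) : ℝ) := by push_cast; positivity
      exact inv_anti₀ this (by exact_mod_cast (by omega))
    have h1 := abs_sum_range_mul_le_of_antitone hc (fun i => by positivity)
      (abs_sum_sin_le htpos ht a) (K - a)
    simp_rw [div_eq_inv_mul]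
    refine h1.trans ?_
    rw [div_le_iff₀ htpos] at ha
    rw [add_zero, ← div_eq_inv_mul, div_div, div_le_iff₀ (by positivity)]
    nlinarith
  rcases le_total p L with hpL | hpL
  · linarith [htail L hpL]
  · rcases le_total K p with hKp | hKp
    · linarith [hhead K hKL (Or.inr hKp)]
    · rw [← Finset.sum_Ico_consecutive _ hpL hKp]
      exact (abs_add_le _ _).trans (add_le_add (hhead p hpL (Or.inr le_rfl)) (htail p le_rfl))

theorem sum_Icc_inv_sq_le {L : ℕ} (hL : 1 ≤ L) (K : ℕ) :
    ∑ j ∈ Finset.Icc L K, ((j : ℝ) ^ 2)⁻¹ ≤ 2 / L := by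
  have h := sum_Ioo_inv_sq_le (α := ℝ) (L - 1) (K + 1)
  have h2 : Finset.Ioo (L - 1) (K + 1) = Finset.Icc L K := by
    ext j
    simp only [Finset.mem_Ioo, Finset.mem_Icc]
    omega
  rw [h2] at h
  refine h.trans_eq ?_
  rw [Nat.cast_sub hL]
  push_cast
  ring

theorem sum_Icc_neg_ite_le_abs {E : Type*} [AddCommMonoid E] {L : ℕ} (hL : 1 ≤ L) (K : ℕ)
    (h : ℤ → E) :
    ∑ k ∈ Finset.Icc (-(K : ℤ)) K, (if (L : ℤ) ≤ |k| then h k else 0) =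
      ∑ j ∈ Finset.Icc L K, (h j + h (-j)) := by
  induction K with
  | zero =>
    rw [Finset.Icc_eq_empty (by omega : ¬L ≤ 0)]
    simp
    omega
  | succ K ih =>
    push_cast
    rw [Finset.Icc_succ_succ, Finset.sum_union, ih, Finset.sum_pair (by omega)]
    · have h1 : |-((K : ℤ) + 1)| = K + 1 := by rw [abs_neg, abs_of_nonneg (by positivity)]
      have h2 : |((K : ℤ) + 1)| = K + 1 := abs_of_nonneg (by positivity)
      rw [h1, h2]
      by_cases hLK : L ≤ K + 1
      · rw [Finset.sum_Icc_succ_top hLK, if_pos (by exact_mod_cast hLK)]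
        push_cast
        rw [if_pos (by exact_mod_cast hLK), add_comm (h (-((K : ℤ) + 1)))]
      · rw [if_neg (by exact_mod_cast hLK), if_neg (by exact_mod_cast hLK),
          Finset.Icc_eq_empty (by omega), Finset.Icc_eq_empty (by omega)]
        simp
    · rw [Finset.disjoint_left]
      intro k hk
      rw [Finset.mem_Icc] at hk
      simp only [Finset.mem_insert, Finset.mem_singleton]
      omega

theorem sum_Icc_neg_ite_nonneg_lt {E : Type*} [AddCommMonoid E] {L K : ℕ} (hLK : L ≤ K + 1)
    (h : ℤ → E) :
    ∑ k ∈ Finset.Icc (-(K : ℤ)) K, (if 0 ≤ k ∧ k < L then h k else 0) =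
      ∑ j ∈ Finset.range L, h j := by
  rw [← Finset.sum_filter]
  refine (Finset.sum_nbij (fun j : ℕ => (j : ℤ)) ?_ ?_ ?_ fun _ _ => rfl).symm
  · intro j hj
    simp only [Finset.mem_range] at hj
    simp only [Finset.mem_filter, Finset.mem_Icc]
    omega
  · intro i _ j _ hij
    simpa using hij
  · intro k hk
    simp only [Finset.coe_filter, Finset.mem_Icc, Set.mem_ofPred_eq] at hk
    refine ⟨k.toNat, ?_, ?_⟩
    · simp only [Finset.coe_range, Set.mem_Iio]
      omega
    · simp only
      omega

/-! ### Trigonometric polynomials with a small derivative and a large one-sided derivative -/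

/-- The value at `0` of `∑_{L ≤ |k| ≤ K} k⁻² e^{ikt}`. -/
def humpMass (L K : ℕ) : ℝ :=
  ∑ j ∈ Finset.Icc L K, 2 * ((j : ℝ) ^ 2)⁻¹

/-- The coefficients of
`∑_{L ≤ |k| ≤ K} k⁻² e^{ikt} - (humpMass L K / L) ∑_{0 ≤ k < L} e^{ikt}`. -/
def humpCoeff (L K : ℕ) (k : ℤ) : ℝ :=
  (if (L : ℤ) ≤ |k| then ((k : ℝ) ^ 2)⁻¹ else 0) -
    if 0 ≤ k ∧ k < (L : ℤ) then humpMass L K / L else 0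

theorem humpMass_nonneg (L K : ℕ) : 0 ≤ humpMass L K :=
  Finset.sum_nonneg fun _ _ => by positivity

theorem humpMass_le {L : ℕ} (hL : 1 ≤ L) (K : ℕ) : humpMass L K ≤ 4 / L := by
  rw [humpMass, ← Finset.mul_sum]
  calc _ ≤ 2 * (2 / (L : ℝ)) := by gcongr; exact sum_Icc_inv_sq_le hL K
    _ = 4 / L := by ring

theorem sum_humpCoeff_mul {L K : ℕ} (hL : 1 ≤ L) (hLK : L ≤ K) (e : ℤ → ℂ) :
    ∑ k ∈ Finset.Icc (-(K : ℤ)) K, (humpCoeff L K k : ℂ) * e k =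
      ∑ j ∈ Finset.Icc L K, (((j : ℝ) ^ 2)⁻¹ : ℂ) * (e j + e (-j)) -
        (humpMass L K / L : ℂ) * ∑ j ∈ Finset.range L, e j := by
  have h1 := sum_Icc_neg_ite_le_abs hL K fun k => ((((k : ℝ) ^ 2)⁻¹ : ℝ) : ℂ) * e k
  have h2 := sum_Icc_neg_ite_nonneg_lt (by omega : L ≤ K + 1) fun k => (humpMass L K / L : ℂ) * e k
  rw [Finset.mul_sum, ← h2]
  have h3 : ∑ j ∈ Finset.Icc L K, (((j : ℝ) ^ 2)⁻¹ : ℂ) * (e j + e (-j)) =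
      ∑ j ∈ Finset.Icc L K, (((((((j : ℤ) : ℝ) ^ 2)⁻¹ : ℝ) : ℂ) * e j +
        (((((-(j : ℤ) : ℤ) : ℝ) ^ 2)⁻¹ : ℝ) : ℂ) * e (-j))) := by
    refine Finset.sum_congr rfl fun j _ => ?_
    push_cast
    ring
  rw [h3, ← h1, ← Finset.sum_sub_distrib]
  refine Finset.sum_congr rfl fun k _ => ?_
  unfold humpCoeff
  split_ifs <;> push_cast <;> ring

theorem trigPoly_humpCoeff_zero {L K : ℕ} (hL : 1 ≤ L) (hLK : L ≤ K) :
    trigPoly (Finset.Icc (-(K : ℤ)) K) (fun k => (humpCoeff L K k : ℂ)) 0 = 0 := by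
  have hL0 : (L : ℂ) ≠ 0 := by exact_mod_cast (by omega : L ≠ 0)
  rw [trigPoly, sum_humpCoeff_mul hL hLK]
  simp only [Complex.ofReal_zero, mul_zero, Complex.exp_zero, Finset.sum_const, Finset.card_range,
    nsmul_eq_mul, mul_one]
  rw [div_mul_cancel₀ _ hL0, humpMass]
  push_cast
  rw [← Finset.sum_sub_distrib]
  exact Finset.sum_eq_zero fun j _ => by ring

/-- The symmetric block differentiates to `-2 ∑ sin(jt)/j`, bounded uniformly in `L` and `K`; the
correction costs at most `(4/L²) · L · L = 4`. -/
theorem norm_deriv_trigPoly_humpCoeff_le {L K : ℕ} (hL : 1 ≤ L) (hLK : L ≤ K) {t : ℝ}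
    (ht : |t| ≤ π) :
    ‖trigPoly (Finset.Icc (-(K : ℤ)) K) (fun k => Complex.I * k * (humpCoeff L K k : ℂ)) t‖ ≤
      2 * (1 + π) + 4 := by
  have hL0 : (0 : ℝ) < L := by exact_mod_cast hL
  have h1 : trigPoly (Finset.Icc (-(K : ℤ)) K) (fun k => Complex.I * k * (humpCoeff L K k : ℂ)) t =
      ∑ k ∈ Finset.Icc (-(K : ℤ)) K, (humpCoeff L K k : ℂ) *
        (Complex.I * k * Complex.exp (Complex.I * k * t)) :=
    Finset.sum_congr rfl fun k _ => by ring
  rw [h1, sum_humpCoeff_mul hL hLK]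
  refine (norm_sub_le _ _).trans (add_le_add ?_ ?_)
  · have h2 : ∑ j ∈ Finset.Icc L K, (((j : ℝ) ^ 2)⁻¹ : ℂ) *
        (Complex.I * ((j : ℤ) : ℂ) * Complex.exp (Complex.I * ((j : ℤ) : ℂ) * t) +
          Complex.I * ((-(j : ℤ) : ℤ) : ℂ) * Complex.exp (Complex.I * ((-(j : ℤ) : ℤ) : ℂ) * t)) =
        ((-2 * ∑ j ∈ Finset.Ico L (K + 1), Real.sin (j * t) / j : ℝ) : ℂ) := by
      rw [Finset.mul_sum, Complex.ofReal_sum]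
      refine Finset.sum_congr (by ext; simp) fun j hj => ?_
      have hj0 : (j : ℂ) ≠ 0 := by
        have := (Finset.mem_Ico.1 hj).1
        exact_mod_cast (by omega : j ≠ 0)
      push_cast
      have e1 : Complex.I * (j : ℂ) * t = (j * t) * Complex.I := by ring
      have e2 : Complex.I * (-(j : ℂ)) * t = -(j * t) * Complex.I := by ring
      rw [e1, e2, Complex.sin]
      field_simp
      ring_nf
    rw [h2, Complex.norm_real, Real.norm_eq_abs, abs_mul]
    have := abs_sum_Ico_sin_div_le ht hL (K + 1)
    norm_num
    linarith
  · rw [norm_mul]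
    have h3 : ‖∑ j ∈ Finset.range L, Complex.I * ((j : ℤ) : ℂ) *
        Complex.exp (Complex.I * ((j : ℤ) : ℂ) * t)‖ ≤ L * L := by
      refine (norm_sum_le _ _).trans ?_
      have h4 : ∀ j ∈ Finset.range L, ‖Complex.I * ((j : ℤ) : ℂ) *
          Complex.exp (Complex.I * ((j : ℤ) : ℂ) * t)‖ ≤ L := by
        intro j hj
        rw [norm_mul, norm_exp_I_mul_int_mul, norm_mul, Complex.norm_I]
        simp only [one_mul, mul_one, Int.cast_natCast, Complex.norm_natCast]
        exact_mod_cast (Finset.mem_range.1 hj).le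
      simpa using Finset.sum_le_card_nsmul _ _ _ h4
    have h5 : ‖(humpMass L K / L : ℂ)‖ = humpMass L K / L := by
      rw [norm_div, Complex.norm_real, Complex.norm_natCast,
        Real.norm_of_nonneg (humpMass_nonneg L K)]
    rw [h5]
    calc humpMass L K / L * _ ≤ 4 / L / L * (L * L) := by
          gcongr
          exact humpMass_le hL K
      _ = 4 := by field_simp

/-- The tail of `∑ j⁻⁴` and the `L` correction terms of size at most `4/L²` are both `O(L⁻³)`. -/
theorem sum_humpCoeff_sq_le {L K : ℕ} (hL : 1 ≤ L) (hLK : L ≤ K) :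
    ∑ k ∈ Finset.Icc (-(K : ℤ)) K, ‖(humpCoeff L K k : ℂ)‖ ^ 2 ≤ 40 / (L : ℝ) ^ 3 := by
  have hL0 : (0 : ℝ) < L := by exact_mod_cast hL
  have h1 := sum_Icc_neg_ite_le_abs hL K fun k => (((k : ℝ) ^ 2)⁻¹) ^ 2
  have h2 := sum_Icc_neg_ite_nonneg_lt (by omega : L ≤ K + 1) fun _ => (humpMass L K / L) ^ 2
  have h3 : ∀ k ∈ Finset.Icc (-(K : ℤ)) K, ‖(humpCoeff L K k : ℂ)‖ ^ 2 ≤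
      2 * (if (L : ℤ) ≤ |k| then (((k : ℝ) ^ 2)⁻¹) ^ 2 else 0) +
      2 * (if 0 ≤ k ∧ k < (L : ℤ) then (humpMass L K / L) ^ 2 else 0) := by
    intro k _
    rw [Complex.norm_real, Real.norm_eq_abs, sq_abs, humpCoeff]
    split_ifs <;> nlinarith [sq_nonneg (((k : ℝ) ^ 2)⁻¹ + humpMass L K / L),
      sq_nonneg (((k : ℝ) ^ 2)⁻¹), sq_nonneg (humpMass L K / L)]
  refine (Finset.sum_le_sum h3).trans ?_
  rw [Finset.sum_add_distrib, ← Finset.mul_sum, ← Finset.mul_sum, h1, h2]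
  have h4 : ∑ j ∈ Finset.Icc L K, (((((j : ℤ) : ℝ) ^ 2)⁻¹) ^ 2 +
      ((((-(j : ℤ) : ℤ) : ℝ) ^ 2)⁻¹) ^ 2) ≤ 2 * (1 / (L : ℝ) ^ 2) * (2 / L) := by
    have h5 : ∀ j ∈ Finset.Icc L K, (((((j : ℤ) : ℝ) ^ 2)⁻¹) ^ 2 +
      ((((-(j : ℤ) : ℤ) : ℝ) ^ 2)⁻¹) ^ 2) ≤ 2 * (1 / (L : ℝ) ^ 2) * ((j : ℝ) ^ 2)⁻¹ := by
      intro j hj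
      have hLj : (L : ℝ) ≤ j := by exact_mod_cast (Finset.mem_Icc.1 hj).1
      have h6 : ((j : ℝ) ^ 2)⁻¹ ≤ 1 / (L : ℝ) ^ 2 := by
        rw [one_div]
        gcongr
      have h7 : 0 ≤ ((j : ℝ) ^ 2)⁻¹ := by positivity
      push_cast
      rw [neg_sq]
      nlinarith
    refine (Finset.sum_le_sum h5).trans ?_
    rw [← Finset.mul_sum]
    gcongr
    exact sum_Icc_inv_sq_le hL K
  have h8 : ∑ j ∈ Finset.range L, (humpMass L K / L) ^ 2 ≤ 16 / (L : ℝ) ^ 3 := by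
    rw [Finset.sum_const, Finset.card_range, nsmul_eq_mul]
    calc (L : ℝ) * (humpMass L K / L) ^ 2 ≤ L * (4 / L / L) ^ 2 := by
          gcongr
          · exact div_nonneg (humpMass_nonneg L K) hL0.le
          · exact humpMass_le hL K
      _ = 16 / (L : ℝ) ^ 3 := by field_simp; norm_num
  calc _ ≤ 2 * (2 * (1 / (L : ℝ) ^ 2) * (2 / L)) + 2 * (16 / (L : ℝ) ^ 3) := by gcongr
    _ = 40 / (L : ℝ) ^ 3 := by field_simp; norm_num

/-- The essential use of `β ≤ 1`: `v^β ≥ v` for `v = 1 - (1 - u)^α` in `[0, 1]`, and `v` is at least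
linear in `u`. -/
theorem mul_le_rieszFun_one_sub {α β : ℝ} (hα : 0 < α) (hβ : 0 < β) (hβ1 : β ≤ 1) {u : ℝ}
    (hu0 : 0 ≤ u) (hu1 : u ≤ 1) : min α 1 * u ≤ rieszFun α β (1 - u) := by
  have h0 : 0 ≤ 1 - u := sub_nonneg.2 hu1
  have hv : min α 1 * u ≤ 1 - (1 - u) ^ α := by
    rcases le_total α 1 with h | h
    · rw [min_eq_left h]
      have := rpow_one_add_le_one_add_mul_self (s := -u) (by linarith) hα.le h
      rw [← sub_eq_add_neg] at this
      linarith
    · rw [min_eq_right h]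
      have : (1 - u) ^ α ≤ 1 - u := by
        rcases h0.eq_or_lt with h0 | h0
        · rw [← h0, Real.zero_rpow hα.ne']
        · simpa using Real.rpow_le_rpow_of_exponent_ge h0 (by linarith) h
      linarith
  have hv0 : 0 ≤ 1 - (1 - u) ^ α := le_trans (by positivity) hv
  refine hv.trans ?_
  rw [rieszFun, abs_of_nonneg h0, max_eq_left hv0]
  rcases hv0.eq_or_lt with h | h
  · rw [← h, Real.zero_rpow hβ.ne']
  · have := Real.rpow_le_rpow_of_exponent_ge h
      (by linarith [Real.rpow_nonneg h0 α]) hβ1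
    simpa using this

theorem log_sub_log_le_sum_inv {L K : ℕ} (hL : 1 ≤ L) (hLK : L ≤ K) :
    Real.log ((K : ℝ) + 1) - Real.log L ≤ ∑ j ∈ Finset.Icc L K, (j : ℝ)⁻¹ := by
  have hstep : ∀ j : ℕ, 1 ≤ j → Real.log ((j : ℝ) + 1) - Real.log j ≤ (j : ℝ)⁻¹ := by
    intro j hj
    have hj0 : (0 : ℝ) < j := by exact_mod_cast hj
    rw [← Real.log_div (by positivity) hj0.ne']
    refine (Real.log_le_sub_one_of_pos (by positivity)).trans_eq ?_
    field_simp
    ring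
  induction K, hLK using Nat.le_induction with
  | base => simpa using hstep L hL
  | succ K hK ih =>
    rw [Finset.sum_Icc_succ_top (by omega)]
    have := hstep (K + 1) (by omega)
    push_cast at *
    linarith

theorem sum_Icc_shift {E : Type*} [AddCommMonoid E] (N K : ℤ) (h : ℤ → E) :
    ∑ k ∈ Finset.Icc (N - K) (N + K), h k = ∑ k ∈ Finset.Icc (-K) K, h (N + k) := by
  refine Finset.sum_nbij' (fun k => k - N) (fun k => N + k) ?_ ?_ ?_ ?_ ?_
  · intro k hk
    rw [Finset.mem_Icc] at *
    omega
  · intro k hk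
    rw [Finset.mem_Icc] at *
    omega
  · intro k _
    ring
  · intro k _
    ring
  · intro k _
    congr 1
    ring

/-- The coefficients of the derivative of the trigonometric polynomial with coefficients
`humpCoeff L K` modulated by `e^{iNt}`. -/
def shiftedHumpCoeff (L K : ℕ) (N k : ℤ) : ℂ :=
  Complex.I * k * (humpCoeff L K (k - N) : ℂ)

theorem trigPoly_shift (N K : ℤ) (b : ℤ → ℂ) (t : ℝ) :
    trigPoly (Finset.Icc (N - K) (N + K)) (fun k => b (k - N)) t =
      Complex.exp (Complex.I * N * t) * trigPoly (Finset.Icc (-K) K) b t := by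
  rw [trigPoly, sum_Icc_shift, trigPoly, Finset.mul_sum]
  refine Finset.sum_congr rfl fun k _ => ?_
  rw [add_sub_cancel_left, mul_left_comm, ← Complex.exp_add]
  congr 2
  push_cast
  ring

theorem norm_trigPoly_humpCoeff_le {L K : ℕ} (hL : 1 ≤ L) (hLK : L ≤ K) {t : ℝ} (ht : |t| ≤ π) :
    ‖trigPoly (Finset.Icc (-(K : ℤ)) K) (fun k => (humpCoeff L K k : ℂ)) t‖ ≤
      (2 * (1 + π) + 4) * |t| := by
  have hpi := Real.pi_pos
  have h := (convex_Icc (-π) π).norm_image_sub_le_of_norm_hasDerivWithin_le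
    (f := trigPoly (Finset.Icc (-(K : ℤ)) K) fun k => (humpCoeff L K k : ℂ))
    (fun x _ => (hasDerivAt_trigPoly _ _ x).hasDerivWithinAt)
    (fun x hx => norm_deriv_trigPoly_humpCoeff_le hL hLK (abs_le.2 hx))
    (⟨by linarith, hpi.le⟩ : (0 : ℝ) ∈ Set.Icc (-π) π) (abs_le.1 ht)
  rwa [trigPoly_humpCoeff_zero hL hLK, sub_zero, sub_zero, Real.norm_eq_abs] at h

/-- The primitive is `e^{iNt} q(t)` with `q(0) = 0`; modulation does not change its modulus, so the
bound is independent of `N`. -/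
theorem norm_integral_shiftedHump_le {L K : ℕ} (hL : 1 ≤ L) (hLK : L ≤ K) (N : ℤ) {y : ℝ}
    (hy : |y| ≤ π) :
    ‖∫ t in (0 : ℝ)..y, trigPoly (Finset.Icc (N - K) (N + K)) (shiftedHumpCoeff L K N) t‖ ≤
      (2 * (1 + π) + 4) * |y| := by
  unfold shiftedHumpCoeff
  rw [intervalIntegral.integral_eq_sub_of_hasDerivAt
    (fun t _ => hasDerivAt_trigPoly (Finset.Icc (N - (K : ℤ)) (N + K))
      (fun k => (humpCoeff L K (k - N) : ℂ)) t)
    ((continuous_trigPoly _ _).intervalIntegrable _ _),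
    trigPoly_shift N K fun k => (humpCoeff L K k : ℂ),
    trigPoly_shift N K fun k => (humpCoeff L K k : ℂ), trigPoly_humpCoeff_zero hL hLK, mul_zero,
    sub_zero, norm_mul, norm_exp_I_mul_int_mul, one_mul]
  exact norm_trigPoly_humpCoeff_le hL hLK hy

theorem norm_shiftedHump_le {L K : ℕ} (hL : 1 ≤ L) (hLK : L ≤ K) (N : ℕ) {t : ℝ} (ht : |t| ≤ π) :
    ‖trigPoly (Finset.Icc ((N : ℤ) - K) (N + K)) (shiftedHumpCoeff L K N) t‖ ≤
      N * ‖trigPoly (Finset.Icc (-(K : ℤ)) K) (fun k => (humpCoeff L K k : ℂ)) t‖ +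
        (2 * (1 + π) + 4) := by
  have h1 : trigPoly (Finset.Icc ((N : ℤ) - K) (N + K)) (shiftedHumpCoeff L K N) t =
      Complex.exp (Complex.I * (N : ℤ) * t) *
        (Complex.I * N * trigPoly (Finset.Icc (-(K : ℤ)) K) (fun k => (humpCoeff L K k : ℂ)) t +
          trigPoly (Finset.Icc (-(K : ℤ)) K)
            (fun k => Complex.I * k * (humpCoeff L K k : ℂ)) t) := by
    have h2 : shiftedHumpCoeff L K N = fun k => (fun j : ℤ => Complex.I * (N + j : ℂ) *
        (humpCoeff L K j : ℂ)) (k - N) := by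
      ext k
      simp [shiftedHumpCoeff]
    rw [h2, trigPoly_shift N K fun j : ℤ => Complex.I * (N + j : ℂ) * (humpCoeff L K j : ℂ)]
    congr 1
    simp only [trigPoly, Finset.mul_sum, ← Finset.sum_add_distrib]
    exact Finset.sum_congr rfl fun k _ => by ring
  rw [h1, norm_mul, norm_exp_I_mul_int_mul, one_mul]
  refine (norm_add_le _ _).trans (add_le_add ?_ (norm_deriv_trigPoly_humpCoeff_le hL hLK ht))
  rw [norm_mul, norm_mul, Complex.norm_I, one_mul, Complex.norm_natCast]

/-- The dangerous term is `N ‖q‖₁`. Parseval gives `‖q‖₁ = O(L^(-3/2)) = O(M⁻³)`, which balances `N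
= 2M³`. -/
theorem integral_norm_shiftedHump_le {M : ℕ} (hM : 1 ≤ M) :
    ∫ t in (-π)..π, ‖trigPoly (Finset.Icc (((2 * M ^ 3 : ℕ) : ℤ) - (M ^ 3 : ℕ))
      (((2 * M ^ 3 : ℕ) : ℤ) + (M ^ 3 : ℕ))) (shiftedHumpCoeff (M ^ 2) (M ^ 3)
        (2 * M ^ 3 : ℕ)) t‖ ≤ 26 * π + (2 * (1 + π) + 4) * (2 * π) := by
  have hpi := Real.pi_pos
  have hM0 : (0 : ℝ) < M := by exact_mod_cast hM
  have hL : 1 ≤ M ^ 2 := Nat.one_le_pow _ _ hM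
  have hLK : M ^ 2 ≤ M ^ 3 := Nat.pow_le_pow_right hM (by norm_num)
  set q := trigPoly (Finset.Icc (-((M ^ 3 : ℕ) : ℤ)) (M ^ 3 : ℕ))
    (fun k => (humpCoeff (M ^ 2) (M ^ 3) k : ℂ)) with hq
  have hqc : Continuous q := continuous_trigPoly _ _
  -- The square is at most `4M⁶ · 2π · 2π · 40/M⁶ = 640π²`, and `640 ≤ 26²`.
  have h1 : ((2 * M ^ 3 : ℕ) : ℝ) * ∫ t in (-π)..π, ‖q t‖ ≤ 26 * π := by
    refine abs_le_of_sq_le_sq' ?_ (by positivity) |>.2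
    have h2 := sq_intervalIntegral_le (u := fun t => ‖q t‖) (by fun_prop)
      (by linarith : -π ≤ π)
    rw [hq, integral_norm_sq_trigPoly, ← hq] at h2
    have h3 := sum_humpCoeff_sq_le hL hLK
    rw [mul_pow]
    calc ((2 * M ^ 3 : ℕ) : ℝ) ^ 2 * (∫ t in (-π)..π, ‖q t‖) ^ 2
        ≤ ((2 * M ^ 3 : ℕ) : ℝ) ^ 2 * ((π - -π) * (2 * π * (40 / ((M ^ 2 : ℕ) : ℝ) ^ 3))) := by
          refine mul_le_mul_of_nonneg_left (h2.trans ?_) (by positivity)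
          refine mul_le_mul_of_nonneg_left ?_ (by linarith)
          exact mul_le_mul_of_nonneg_left h3 (by positivity)
      _ = 640 * π ^ 2 := by
          push_cast
          field_simp
          ring
      _ ≤ (26 * π) ^ 2 := by nlinarith [sq_nonneg π]
  have hcF := continuous_trigPoly (Finset.Icc (((2 * M ^ 3 : ℕ) : ℤ) - (M ^ 3 : ℕ))
      (((2 * M ^ 3 : ℕ) : ℤ) + (M ^ 3 : ℕ))) (shiftedHumpCoeff (M ^ 2) (M ^ 3)
        (2 * M ^ 3 : ℕ))
  have hc1 : Continuous fun t => ((2 * M ^ 3 : ℕ) : ℝ) * ‖q t‖ := by fun_prop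
  have hc2 : Continuous fun t => ((2 * M ^ 3 : ℕ) : ℝ) * ‖q t‖ + (2 * (1 + π) + 4) := by fun_prop
  have h4 := intervalIntegral.integral_mono_on (μ := volume) (by linarith : -π ≤ π)
    (hcF.norm.intervalIntegrable _ _)
    (hc2.intervalIntegrable _ _)
    fun t ht => norm_shiftedHump_le hL hLK (2 * M ^ 3) (abs_le.2 ht)
  refine h4.trans ?_
  rw [intervalIntegral.integral_add (hc1.intervalIntegrable _ _)
    (continuous_const.intervalIntegrable _ _), intervalIntegral.integral_const_mul,
    intervalIntegral.integral_const, smul_eq_mul]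
  refine add_le_add h1 (le_of_eq (by ring))

/-- Only the frequencies `N - j` survive, all with the same phase, and each contributes at least
`min(α, 1)/(2j)`. The harmonic sum from `M²` to `M³` yields `log M`. -/
theorem le_norm_sum_rieszFun_shiftedHump {α β : ℝ} (hα : 0 < α) (hβ : 0 < β) (hβ1 : β ≤ 1)
    {M : ℕ} (hM : 1 ≤ M) :
    min α 1 / 2 * Real.log M ≤ ‖∑ k ∈ Finset.Icc (((2 * M ^ 3 : ℕ) : ℤ) - (M ^ 3 : ℕ))
      (((2 * M ^ 3 : ℕ) : ℤ) + (M ^ 3 : ℕ)),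
        (rieszFun α β ((k : ℝ) / ((2 * M ^ 3 : ℕ) : ℝ)) : ℂ) *
          shiftedHumpCoeff (M ^ 2) (M ^ 3) (2 * M ^ 3 : ℕ) k‖ := by
  have hL : 1 ≤ M ^ 2 := Nat.one_le_pow _ _ hM
  have hLK : M ^ 2 ≤ M ^ 3 := Nat.pow_le_pow_right hM (by norm_num)
  have hM0 : (0 : ℝ) < M := by exact_mod_cast hM
  set N := 2 * M ^ 3 with hN
  set L := M ^ 2
  set K := M ^ 3
  have hK0 : 0 < K := by positivity
  have hN0 : (0 : ℝ) < N := by exact_mod_cast (by omega : 0 < N)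
  set e : ℤ → ℝ := fun k => ((N + k : ℤ) : ℝ) * rieszFun α β (((N + k : ℤ) : ℝ) / N) with he
  -- The cutoff removes both the upper half of the block and the whole correction.
  have hzero : ∀ j : ℕ, e j = 0 := by
    intro j
    simp only [he]
    rw [rieszFun_eq_zero hα hβ, mul_zero]
    rw [le_abs]
    left
    rw [one_le_div hN0]
    push_cast
    linarith [(Nat.cast_nonneg j : (0 : ℝ) ≤ j)]
  have h1 : ∑ k ∈ Finset.Icc ((N : ℤ) - K) (N + K),
        (rieszFun α β ((k : ℝ) / (N : ℝ)) : ℂ) * shiftedHumpCoeff L K N k =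
      Complex.I * ((∑ j ∈ Finset.Icc L K, ((j : ℝ) ^ 2)⁻¹ * e (-j) : ℝ) : ℂ) := by
    have h2 := sum_humpCoeff_mul hL hLK fun k => (e k : ℂ)
    simp only [hzero, Complex.ofReal_zero, Finset.sum_const_zero, mul_zero, sub_zero,
      zero_add] at h2
    push_cast at h2 ⊢
    rw [sum_Icc_shift, ← h2, Finset.mul_sum]
    refine Finset.sum_congr rfl fun k _ => ?_
    simp only [shiftedHumpCoeff, he, add_sub_cancel_left]
    push_cast
    ring
  rw [h1, norm_mul, Complex.norm_I, one_mul, Complex.norm_real, Real.norm_eq_abs]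
  refine le_trans ?_ (le_abs_self _)
  have h3 : ∀ j ∈ Finset.Icc L K, min α 1 / 2 * (j : ℝ)⁻¹ ≤ ((j : ℝ) ^ 2)⁻¹ * e (-j) := by
    intro j hj
    rw [Finset.mem_Icc] at hj
    have hj0 : (0 : ℝ) < j := by exact_mod_cast (by omega : 0 < j)
    -- Because `j ≤ K = N/2`, the derivative factor `N - j` is still at least `N/2`.
    have hjN : (j : ℝ) ≤ N / 2 := by
      have : (2 * j : ℝ) ≤ N := by exact_mod_cast (by omega : 2 * j ≤ N)
      linarith
    have h4 := mul_le_rieszFun_one_sub hα hβ hβ1 (u := j / N) (by positivity)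
      (by rw [div_le_one hN0]; linarith)
    have h5 : e (-j) = (N - j) * rieszFun α β (1 - j / N) := by
      simp only [he]
      push_cast
      rw [← sub_eq_add_neg, sub_div, div_self hN0.ne']
    have hm : 0 < min α 1 := lt_min hα one_pos
    rw [h5]
    calc min α 1 / 2 * (j : ℝ)⁻¹ = ((j : ℝ) ^ 2)⁻¹ * (N / 2 * (min α 1 * (j / N))) := by
          field_simp
      _ ≤ _ := by
          refine mul_le_mul_of_nonneg_left ?_ (by positivity)
          exact mul_le_mul (by linarith) h4 (by positivity) (by linarith)
  refine le_trans ?_ (Finset.sum_le_sum h3)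
  rw [← Finset.mul_sum]
  refine mul_le_mul_of_nonneg_left (le_trans ?_ (log_sub_log_le_sum_inv hL hLK)) (by positivity)
  have h6 : Real.log ((K : ℕ) : ℝ) ≤ Real.log ((K : ℝ) + 1) :=
    Real.log_le_log (by exact_mod_cast hK0) (by linarith)
  have h7 : Real.log ((K : ℕ) : ℝ) = 3 * Real.log M := by
    simp [K]
  have h8 : Real.log ((L : ℕ) : ℝ) = 2 * Real.log M := by
    simp [L]
  rw [h8]
  linarith

/-! ### Divergence for `β ≤ 1` by a gliding hump -/

/-- Tonelli makes the sum of the norms integrable; it gives almost everywhere convergence, hence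
measurability, and dominates the sum. -/
theorem integrable_tsum_of_summable_integral_norm {X E : Type*} [MeasurableSpace X]
    [NormedAddCommGroup E] [CompleteSpace E] {μ : Measure X} {F : ℕ → X → E}
    (hF : ∀ i, Integrable (F i) μ) (hs : Summable fun i => ∫ x, ‖F i x‖ ∂μ) :
    Integrable (fun x => ∑' i, F i x) μ := by
  have hfin : ∫⁻ x, ∑' i, ‖F i x‖ₑ ∂μ < ⊤ := by
    rw [lintegral_tsum fun i => (hF i).1.enorm]
    have h1 : ∀ i, ∫⁻ x, ‖F i x‖ₑ ∂μ = ENNReal.ofReal (∫ x, ‖F i x‖ ∂μ) := fun i =>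
      (ofReal_integral_norm_eq_lintegral_enorm (hF i)).symm
    simp_rw [h1]
    exact hs.tsum_ofReal_lt_top
  have hae : ∀ᵐ x ∂μ, Summable fun i => F i x := by
    filter_upwards [ae_lt_top' (AEMeasurable.tsum fun i => (hF i).1.enorm) hfin.ne] with x hx
    have : Summable fun i => ‖F i x‖₊ := ENNReal.tsum_coe_ne_top_iff_summable.1 hx.ne
    exact this.of_nnnorm
  have hmeas : AEStronglyMeasurable (fun x => ∑' i, F i x) μ := by
    refine aestronglyMeasurable_of_tendsto_ae atTop
      (f := fun n x => ∑ i ∈ Finset.range n, F i x)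
      (fun n => Finset.aestronglyMeasurable_fun_sum _ fun i _ => (hF i).1) ?_
    filter_upwards [hae] with x hx
    exact hx.hasSum.tendsto_sum_nat
  refine ⟨hmeas, lt_of_le_of_lt (lintegral_mono fun x => ?_) hfin⟩
  exact enorm_tsum_le_tsum_enorm

/-! ### Superpositions with weights `2^{-i}` -/

section Superposition

variable {F : ℕ → C(AddCircle (2 * π), ℂ)} {C : ℝ}

theorem integrable_continuousMap (g : C(AddCircle (2 * π), ℂ)) :
    Integrable g AddCircle.haarAddCircle :=
  (map_continuous g).integrable_of_hasCompactSupport (HasCompactSupport.of_compactSpace _)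

theorem integral_norm_half_pow_smul_le
    (hC : ∀ i, ∫ t in (-π)..π, ‖F i (t : AddCircle (2 * π))‖ ≤ C) (i : ℕ) :
    ∫ y, ‖((1 / 2 : ℂ) ^ i) * F i y‖ ∂AddCircle.haarAddCircle ≤ (1 / 2 : ℝ) ^ i * C := by
  have hpi : 1 ≤ 2 * π := by linarith [Real.pi_gt_three]
  simp_rw [norm_mul, integral_const_mul]
  have h1 : ‖(1 / 2 : ℂ) ^ i‖ = (1 / 2 : ℝ) ^ i := by simp
  rw [h1, integral_haarAddCircle_eq_intervalIntegral _ (-π), show -π + 2 * π = π by ring,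
    smul_eq_mul]
  refine mul_le_mul_of_nonneg_left ?_ (by positivity)
  have h2 : 0 ≤ ∫ t in (-π)..π, ‖F i (t : AddCircle (2 * π))‖ :=
    intervalIntegral.integral_nonneg (by linarith) fun _ _ => norm_nonneg _
  exact (mul_le_of_le_one_left h2 (inv_le_one_of_one_le₀ hpi)).trans (hC i)

theorem summable_integral_norm_half_pow_smul
    (hC : ∀ i, ∫ t in (-π)..π, ‖F i (t : AddCircle (2 * π))‖ ≤ C) :
    Summable fun i => ∫ y, ‖((1 / 2 : ℂ) ^ i) * F i y‖ ∂AddCircle.haarAddCircle :=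
  .of_nonneg_of_le (fun _ => integral_nonneg fun _ => norm_nonneg _)
    (integral_norm_half_pow_smul_le hC)
    ((summable_geometric_of_lt_one (by norm_num) (by norm_num)).mul_right C)

theorem integrable_superposition
    (hC : ∀ i, ∫ t in (-π)..π, ‖F i (t : AddCircle (2 * π))‖ ≤ C) :
    Integrable (fun y => ∑' i, ((1 / 2 : ℂ) ^ i) * F i y) AddCircle.haarAddCircle :=
  integrable_tsum_of_summable_integral_norm
    (fun i => (integrable_continuousMap (F i)).const_mul _)
    (summable_integral_norm_half_pow_smul hC)

theorem hasSum_fourierCoeff_superposition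
    (hC : ∀ i, ∫ t in (-π)..π, ‖F i (t : AddCircle (2 * π))‖ ≤ C) (k : ℤ) :
    HasSum (fun i => ((1 / 2 : ℂ) ^ i) * fourierCoeff (F i) k)
      (fourierCoeff (fun y => ∑' i, ((1 / 2 : ℂ) ^ i) * F i y) k) := by
  have h1 := hasSum_integral_of_summable_integral_norm (μ := AddCircle.haarAddCircle)
    (F := fun i (y : AddCircle (2 * π)) => fourier (-k) y • (((1 / 2 : ℂ) ^ i) * F i y))
    (fun i => ((integrable_continuousMap (F i)).const_mul _).fourier_smul _) (by
      refine (summable_integral_norm_half_pow_smul hC).congr fun i => ?_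
      refine integral_congr_ae (Eventually.of_forall fun y => ?_)
      simp only
      rw [norm_smul, fourier_apply, Circle.norm_coe, one_mul])
  have h2 : ∀ i, ∫ y : AddCircle (2 * π), fourier (-k) y • (((1 / 2 : ℂ) ^ i) * F i y)
      ∂AddCircle.haarAddCircle = ((1 / 2 : ℂ) ^ i) * fourierCoeff (F i) k := fun i =>
    fourierCoeff.const_mul (F i) ((1 / 2 : ℂ) ^ i) k
  simp_rw [h2] at h1
  simp_rw [smul_eq_mul, tsum_mul_left] at h1
  exact h1

theorem hasSum_multiplierMean_superposition {α β : ℝ} (hα : 0 < α) (hβ : 0 < β)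
    (hC : ∀ i, ∫ t in (-π)..π, ‖F i (t : AddCircle (2 * π))‖ ≤ C) (n : ℕ) (x : ℝ) :
    HasSum (fun i => ((1 / 2 : ℂ) ^ i) * multiplierMean (rieszFun α β) (F i) n x)
      (multiplierMean (rieszFun α β) (fun y => ∑' i, ((1 / 2 : ℂ) ^ i) * F i y) n x) := by
  simp_rw [multiplierMean_rieszFun hα hβ]
  have h1 := hasSum_sum (s := Finset.Icc (-(n : ℤ)) n) fun k _ =>
    ((hasSum_fourierCoeff_superposition hC k).mul_left
      (rieszFun α β ((k : ℝ) / ((n : ℝ) + 1)) : ℂ)).mul_right (Complex.exp (Complex.I * k * x))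
  refine h1.congr_fun fun i => ?_
  rw [Finset.mul_sum]
  exact Finset.sum_congr rfl fun k _ => by ring

theorem hasSum_integral_superposition
    (hC : ∀ i, ∫ t in (-π)..π, ‖F i (t : AddCircle (2 * π))‖ ≤ C) {y : ℝ} (hy : |y| ≤ π) :
    HasSum (fun i => ((1 / 2 : ℂ) ^ i) * ∫ t in (0 : ℝ)..y, F i (t : AddCircle (2 * π)))
      (∫ t in (0 : ℝ)..y, ∑' i, ((1 / 2 : ℂ) ^ i) * F i (t : AddCircle (2 * π))) := by
  have hpi := Real.pi_pos
  have hcont : ∀ i, Continuous fun t : ℝ => F i (t : AddCircle (2 * π)) := fun i =>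
    (map_continuous (F i)).comp (AddCircle.continuous_mk' _)
  have hsub : Set.uIoc 0 y ⊆ Set.Ioc (-π) π := by
    intro t ht
    rw [Set.mem_uIoc] at ht
    rw [abs_le] at hy
    rcases ht with ht | ht
    · exact ⟨by linarith, by linarith⟩
    · exact ⟨by linarith, by linarith⟩
  have hint : ∀ i, IntegrableOn (fun t : ℝ => ((1 / 2 : ℂ) ^ i) * F i (t : AddCircle (2 * π)))
      (Set.Ioc (-π) π) := fun i =>
    (intervalIntegrable_iff_integrableOn_Ioc_of_le (by linarith)).1
      ((continuous_const.mul (hcont i)).intervalIntegrable _ _)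
  have h1 := hasSum_integral_of_summable_integral_norm (μ := volume.restrict (Set.uIoc 0 y))
    (F := fun i (t : ℝ) => ((1 / 2 : ℂ) ^ i) * F i (t : AddCircle (2 * π)))
    (fun i => (hint i).mono_set hsub) (by
      refine .of_nonneg_of_le (fun _ => integral_nonneg fun _ => norm_nonneg _) (fun i => ?_)
        ((summable_geometric_of_lt_one (r := (1 / 2 : ℝ)) (by norm_num) (by norm_num)).mul_right C)
      refine (setIntegral_mono_set (hint i).norm
        (Eventually.of_forall fun _ => norm_nonneg _) hsub.eventuallyLE).trans ?_
      simp_rw [norm_mul]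
      rw [← intervalIntegral.integral_of_le (by linarith), intervalIntegral.integral_const_mul]
      have h2 : ‖(1 / 2 : ℂ) ^ i‖ = (1 / 2 : ℝ) ^ i := by simp
      rw [h2]
      exact mul_le_mul_of_nonneg_left (hC i) (by positivity))
  -- `uIoc` forgets the orientation of the interval; the sign restores it.
  have h3 := h1.const_smul (if (0 : ℝ) ≤ y then (1 : ℝ) else -1)
  simp_rw [← intervalIntegral.intervalIntegral_eq_integral_uIoc,
    intervalIntegral.integral_const_mul] at h3
  exact h3

/-- Each difference quotient at `0` is at most `2^{-i} C` in norm and converges because `F i` is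
continuous, so dominated convergence for series applies. -/
theorem isDPointWith_superposition
    (hC : ∀ i, ∫ t in (-π)..π, ‖F i (t : AddCircle (2 * π))‖ ≤ C)
    (hC' : ∀ i y, |y| ≤ π → ‖∫ t in (0 : ℝ)..y, F i (t : AddCircle (2 * π))‖ ≤ C * |y|) :
    IsDPointWith (fun y => ∑' i, ((1 / 2 : ℂ) ^ i) * F i y) 0
      (∑' i, ((1 / 2 : ℂ) ^ i) * F i 0) := by
  have hpi := Real.pi_pos
  have hcont : ∀ i, Continuous fun t : ℝ => F i (t : AddCircle (2 * π)) := fun i =>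
    (map_continuous (F i)).comp (AddCircle.continuous_mk' _)
  unfold IsDPointWith
  rw [hasDerivAt_iff_tendsto_slope_zero]
  have hev : ∀ᶠ y : ℝ in 𝓝[≠] 0, |y| ≤ π := by
    refine nhdsWithin_le_nhds ?_
    filter_upwards [Metric.ball_mem_nhds (0 : ℝ) hpi] with y hy
    rw [Metric.mem_ball, dist_zero_right] at hy
    exact hy.le
  have hlim : Tendsto (fun y : ℝ => ∑' i, y⁻¹ • (((1 / 2 : ℂ) ^ i) *
      ∫ t in (0 : ℝ)..y, F i (t : AddCircle (2 * π)))) (𝓝[≠] 0)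
      (𝓝 (∑' i, ((1 / 2 : ℂ) ^ i) * F i 0)) := by
    refine tendsto_tsum_of_dominated_convergence (bound := fun i => (1 / 2 : ℝ) ^ i * C)
      ((summable_geometric_of_lt_one (by norm_num) (by norm_num)).mul_right C) (fun i => ?_) ?_
    · have h1 := ((hcont i).integral_hasStrictDerivAt 0 0).hasDerivAt
      rw [hasDerivAt_iff_tendsto_slope_zero] at h1
      simp only [zero_add, intervalIntegral.integral_same, sub_zero] at h1
      have h2 := h1.const_mul ((1 / 2 : ℂ) ^ i)
      simp only [mul_smul_comm] at h2
      exact h2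
    · filter_upwards [hev, self_mem_nhdsWithin] with y hy hy0 i
      have h2 : ‖(1 / 2 : ℂ) ^ i‖ = (1 / 2 : ℝ) ^ i := by simp
      have hy1 : 0 < |y| := abs_pos.2 hy0
      rw [norm_smul, norm_mul, h2, norm_inv, Real.norm_eq_abs, mul_left_comm]
      refine mul_le_mul_of_nonneg_left ?_ (by positivity)
      rw [inv_mul_le_iff₀ hy1, mul_comm |y| C]
      exact hC' i y hy
  refine hlim.congr' ?_
  filter_upwards [hev] with y hy
  simp only [zero_add, intervalIntegral.integral_same, sub_zero]
  exact ((hasSum_integral_superposition hC hy).const_smul y⁻¹).tsum_eq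

end Superposition

/-- The building block for divergence: a trigonometric polynomial with spectrum in
`[M ^ 3, 3 M ^ 3]`. -/
def humpPoly (M : ℕ) : C(AddCircle (2 * π), ℂ) :=
  circlePoly (Finset.Icc (((2 * M ^ 3 : ℕ) : ℤ) - (M ^ 3 : ℕ))
    (((2 * M ^ 3 : ℕ) : ℤ) + (M ^ 3 : ℕ))) (shiftedHumpCoeff (M ^ 2) (M ^ 3) (2 * M ^ 3 : ℕ))

theorem multiplierMean_humpPoly (α β : ℝ) (M n : ℕ) :
    multiplierMean (rieszFun α β) (humpPoly M) n 0 =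
      ∑ k ∈ Finset.Icc (((2 * M ^ 3 : ℕ) : ℤ) - (M ^ 3 : ℕ))
        (((2 * M ^ 3 : ℕ) : ℤ) + (M ^ 3 : ℕ)), (rieszFun α β ((k : ℝ) / ((n : ℝ) + 1)) : ℂ) *
          shiftedHumpCoeff (M ^ 2) (M ^ 3) (2 * M ^ 3 : ℕ) k := by
  rw [humpPoly, multiplierMean_circlePoly]
  simp

theorem multiplierMean_humpPoly_eq_zero {α β : ℝ} (hα : 0 < α) (hβ : 0 < β) {M n : ℕ}
    (h : n + 1 ≤ M ^ 3) : multiplierMean (rieszFun α β) (humpPoly M) n 0 = 0 := by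
  rw [multiplierMean_humpPoly]
  refine Finset.sum_eq_zero fun k hk => ?_
  rw [rieszFun_div_eq_zero hα hβ, Complex.ofReal_zero, zero_mul]
  rw [Finset.mem_Icc] at *
  push_cast at hk
  have : ((n + 1 : ℕ) : ℤ) ≤ ((M ^ 3 : ℕ) : ℤ) := by exact_mod_cast h
  push_cast at this
  intro h2
  linarith [hk.1, h2.2]

theorem exists_norm_multiplierMean_humpPoly_le {α β : ℝ} (hβ : 0 < β) (M : ℕ) :
    ∃ B, ∀ n, ‖multiplierMean (rieszFun α β) (humpPoly M) n 0‖ ≤ B := by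
  refine ⟨∑ k ∈ Finset.Icc (((2 * M ^ 3 : ℕ) : ℤ) - (M ^ 3 : ℕ))
        (((2 * M ^ 3 : ℕ) : ℤ) + (M ^ 3 : ℕ)),
          ‖shiftedHumpCoeff (M ^ 2) (M ^ 3) (2 * M ^ 3 : ℕ) k‖, fun n => ?_⟩
  rw [multiplierMean_humpPoly]
  refine (norm_sum_le _ _).trans (Finset.sum_le_sum fun k _ => ?_)
  rw [norm_mul, Complex.norm_real, Real.norm_of_nonneg (rieszFun_nonneg _ _ _)]
  exact mul_le_of_le_one_left (norm_nonneg _) (rieszFun_le_one hβ.le _)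

theorem le_norm_multiplierMean_humpPoly {α β : ℝ} (hα : 0 < α) (hβ : 0 < β) (hβ1 : β ≤ 1)
    {M : ℕ} (hM : 1 ≤ M) : min α 1 / 2 * Real.log M ≤
      ‖multiplierMean (rieszFun α β) (humpPoly M) (2 * M ^ 3 - 1) 0‖ := by
  have h1 : ((2 * M ^ 3 - 1 : ℕ) : ℝ) + 1 = ((2 * M ^ 3 : ℕ) : ℝ) := by
    have : 0 < M ^ 3 := by positivity
    exact_mod_cast (by omega : 2 * M ^ 3 - 1 + 1 = 2 * M ^ 3)
  rw [multiplierMean_humpPoly, h1]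
  exact le_norm_sum_rieszFun_shiftedHump hα hβ hβ1 hM

/-- Gliding-hump selection: the logarithm is unbounded, so each `M j` can outweigh all its
predecessors despite the weight `2^{-j}`. -/
theorem exists_lacunary_sequence (B : ℕ → ℝ) {c : ℝ} (hc : 0 < c) :
    ∃ M : ℕ → ℕ, (∀ j, 1 ≤ M j) ∧ (∀ j, 2 * M j ≤ M (j + 1)) ∧
      ∀ j : ℕ, (j : ℝ) + ∑ i ∈ Finset.range j, B (M i) ≤ (1 / 2 : ℝ) ^ j * (c * Real.log (M j)) := by
  have hex : ∀ (j m : ℕ) (T : ℝ), ∃ M : ℕ, 1 ≤ M ∧ 2 * m ≤ M ∧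
      (j : ℝ) + T ≤ (1 / 2 : ℝ) ^ j * (c * Real.log M) := by
    intro j m T
    have h1 : Tendsto (fun M : ℕ => (1 / 2 : ℝ) ^ j * (c * Real.log M)) atTop atTop :=
      ((Real.tendsto_log_atTop.comp tendsto_natCast_atTop_atTop).const_mul_atTop hc).const_mul_atTop
        (by positivity)
    obtain ⟨M, h2, h3, h4⟩ := ((eventually_ge_atTop 1).and ((eventually_ge_atTop (2 * m)).and
      (h1.eventually_ge_atTop ((j : ℝ) + T)))).exists
    exact ⟨M, h2, h3, h4⟩
  choose Φ hΦ1 hΦ2 hΦ3 using hex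
  -- The recursion carries `M j` together with the accumulated sum of `B (M i)` over `i < j`.
  let p : ℕ → ℕ × ℝ := fun j => Nat.rec (Φ 0 0 0, 0)
    (fun j p => (Φ (j + 1) p.1 (p.2 + B p.1), p.2 + B p.1)) j
  have hp : ∀ j, (p j).2 = ∑ i ∈ Finset.range j, B (p i).1 := by
    intro j
    induction j with
    | zero => rfl
    | succ j ih =>
      rw [Finset.sum_range_succ, ← ih]
  refine ⟨fun j => (p j).1, fun j => ?_, fun j => hΦ2 _ _ _, fun j => ?_⟩
  · cases j with
    | zero => exact hΦ1 _ _ _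
    | succ j => exact hΦ1 _ _ _
  · simp only
    rw [← hp]
    cases j with
    | zero => exact hΦ3 0 0 0
    | succ j => exact hΦ3 (j + 1) _ _

theorem exists_divergent_rieszMean {α β : ℝ} (hα : 0 < α) (hβ : 0 < β) (hβ1 : β ≤ 1) :
    ∃ f : AddCircle (2 * π) → ℂ, Integrable f AddCircle.haarAddCircle ∧
      (∃ d, IsDPointWith f 0 d) ∧
      ¬∃ L : ℂ, Tendsto (fun n : ℕ => multiplierMean (rieszFun α β) f n 0) atTop (𝓝 L) := by
  have hpi := Real.pi_pos
  choose B hB using fun M => exists_norm_multiplierMean_humpPoly_le (α := α) hβ M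
  obtain ⟨M, hM1, hM2, hM3⟩ := exists_lacunary_sequence B
    (c := min α 1 / 2) (half_pos (lt_min hα one_pos))
  set C := 26 * π + (2 * (1 + π) + 4) * (2 * π) with hCdef
  have hL : ∀ j, 1 ≤ M j ^ 2 := fun j => Nat.one_le_pow _ _ (hM1 j)
  have hLK : ∀ j, M j ^ 2 ≤ M j ^ 3 := fun j => Nat.pow_le_pow_right (hM1 j) (by norm_num)
  have hC : ∀ i, ∫ t in (-π)..π, ‖humpPoly (M i) (t : AddCircle (2 * π))‖ ≤ C := fun i => by
    simp_rw [humpPoly, circlePoly_coe]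
    exact integral_norm_shiftedHump_le (hM1 i)
  have hC' : ∀ i y, |y| ≤ π →
      ‖∫ t in (0 : ℝ)..y, humpPoly (M i) (t : AddCircle (2 * π))‖ ≤ C * |y| := fun i y hy => by
    simp_rw [humpPoly, circlePoly_coe]
    refine (norm_integral_shiftedHump_le (hL i) (hLK i) _ hy).trans ?_
    refine mul_le_mul_of_nonneg_right ?_ (abs_nonneg y)
    rw [hCdef]
    nlinarith [Real.pi_gt_three]
  refine ⟨fun y => ∑' i, ((1 / 2 : ℂ) ^ i) * humpPoly (M i) y, integrable_superposition hC,
    ⟨_, isDPointWith_superposition hC hC'⟩, ?_⟩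
  rintro ⟨L, hLim⟩
  obtain ⟨R, hR⟩ := hLim.norm.bddAbove_range
  obtain ⟨j, hj⟩ := exists_nat_gt R
  have hmono : Monotone M := monotone_nat_of_le_succ fun i => by
    have := hM2 i
    omega
  have hsum := hasSum_multiplierMean_superposition (F := fun i => humpPoly (M i)) hα hβ hC
    (2 * M j ^ 3 - 1) 0
  -- At `n + 1 = 2 (M j)³` the later humps are invisible: their spectra start at `(M i)³ ≥ 8 (M
  -- j)³`.
  have hzero : ∀ i ∉ Finset.range (j + 1), ((1 / 2 : ℂ) ^ i) *
      multiplierMean (rieszFun α β) (humpPoly (M i)) (2 * M j ^ 3 - 1) 0 = 0 := by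
    intro i hi
    rw [Finset.mem_range, not_lt] at hi
    have h1 : 2 * M j ≤ M i := (hM2 j).trans (hmono hi)
    have h2 : (2 * M j) ^ 3 ≤ M i ^ 3 := Nat.pow_le_pow_left h1 3
    have h3 : 1 ≤ M j ^ 3 := Nat.one_le_pow _ _ (hM1 j)
    rw [mul_pow] at h2
    rw [multiplierMean_humpPoly_eq_zero hα hβ (by omega), mul_zero]
  have heq := hsum.unique (hasSum_sum_of_ne_finset_zero hzero)
  have hle := hR ⟨2 * M j ^ 3 - 1, rfl⟩
  simp only at hle
  rw [heq, Finset.sum_range_succ] at hle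
  have hnorm : ∀ i, ‖((1 / 2 : ℂ) ^ i)‖ = (1 / 2 : ℝ) ^ i := fun i => by simp
  have h4 : ‖∑ i ∈ Finset.range j, ((1 / 2 : ℂ) ^ i) *
      multiplierMean (rieszFun α β) (humpPoly (M i)) (2 * M j ^ 3 - 1) 0‖ ≤
      ∑ i ∈ Finset.range j, B (M i) := by
    refine (norm_sum_le _ _).trans (Finset.sum_le_sum fun i _ => ?_)
    rw [norm_mul, hnorm]
    refine le_trans (mul_le_of_le_one_left (norm_nonneg _) ?_) (hB _ _)
    exact pow_le_one₀ (by norm_num) (by norm_num)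
  have h5 : (1 / 2 : ℝ) ^ j * (min α 1 / 2 * Real.log (M j)) ≤ ‖((1 / 2 : ℂ) ^ j) *
      multiplierMean (rieszFun α β) (humpPoly (M j)) (2 * M j ^ 3 - 1) 0‖ := by
    rw [norm_mul, hnorm]
    exact mul_le_mul_of_nonneg_left (le_norm_multiplierMean_humpPoly hα hβ hβ1 (hM1 j))
      (by positivity)
  -- The `j`-th hump minus the earlier ones leaves at least `j > R`, contradicting the bound `R` on
  -- the means.
  have h6 := norm_sub_le_norm_add (((1 / 2 : ℂ) ^ j) *
      multiplierMean (rieszFun α β) (humpPoly (M j)) (2 * M j ^ 3 - 1) 0)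
    (∑ i ∈ Finset.range j, ((1 / 2 : ℂ) ^ i) *
      multiplierMean (rieszFun α β) (humpPoly (M i)) (2 * M j ^ 3 - 1) 0)
  rw [add_comm] at hle
  linarith [hM3 j]

end

theorem mainTheorem8 (α β : ℝ) (hα : 0 < α) (hβ : 0 < β) :
    (1 < β ↔ ∀ f : AddCircle (2 * π) → ℂ, Integrable f AddCircle.haarAddCircle →
      ∀ (x : ℝ) (d : ℂ), IsDPointWith f x d →
        Tendsto (fun n : ℕ => multiplierMean (rieszFun α β) f n x) atTop (𝓝 d)) ∧
    (1 < β ↔ ∀ f : AddCircle (2 * π) → ℂ, Integrable f AddCircle.haarAddCircle →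
      ∀ (x : ℝ) (d : ℂ), IsDPointWith f x d →
        ∃ L : ℂ, Tendsto (fun n : ℕ => multiplierMean (rieszFun α β) f n x) atTop (𝓝 L)) := by
  have hpos : 1 < β → ∀ f : AddCircle (2 * π) → ℂ, Integrable f AddCircle.haarAddCircle →
      ∀ (x : ℝ) (d : ℂ), IsDPointWith f x d →
        Tendsto (fun n : ℕ => multiplierMean (rieszFun α β) f n x) atTop (𝓝 d) :=
    fun h f hf x d hd => tendsto_multiplierMean_rieszFun hα h hf hd
  have hneg : (∀ f : AddCircle (2 * π) → ℂ, Integrable f AddCircle.haarAddCircle →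
      ∀ (x : ℝ) (d : ℂ), IsDPointWith f x d →
        ∃ L : ℂ, Tendsto (fun n : ℕ => multiplierMean (rieszFun α β) f n x) atTop (𝓝 L)) →
      1 < β := by
    intro h
    by_contra hβ1
    obtain ⟨f, hf, ⟨d, hd⟩, hdiv⟩ := exists_divergent_rieszMean hα hβ (not_lt.1 hβ1)
    exact hdiv (h f hf 0 d hd)
  exact ⟨⟨hpos, fun h => hneg fun f hf x d hd => ⟨d, h f hf x d hd⟩⟩,
    ⟨fun h f hf x d hd => ⟨d, hpos h f hf x d hd⟩, hneg⟩⟩
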